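/- Let $G = G_1 \ast \langle a\rangle \ast \langle b\rangle$ be a free product decomposition of a group $G$, with $a,b$ of infinite order, and let $1\ne g_1\in G_1$. A free factor system of $G$ is a set $\{[H_1],\dots,[H_p]\}$ of conjugacy classes of non-trivial subgroups with $G=H_1\ast\dots\ast H_p\ast F$ for some free subgroup $F$ of finite (possibly zero) rank; it is proper if it is not $\{[G]\}$; and $\mathcal A\sqsubseteq\mathcal B$ means that every subgroup in a class of $\mathcal A$ is contained in a subgroup in a class of $\mathcal B$. Put $\mathcal G=\{[G_1]\}$, let $\mathcal O$ be the associated relative outer space, and let $\mathrm{Out}(G,\mathcal O)\le \mathrm{Out}(G)$ be the group of outer automorphisms preserving $\mathcal G$. An element $\Phi\in \mathrm{Out}(G,\mathcal O)$ is IWIP relative to $\mathcal O$ if for every $k\ge 1$ the system $\mathcal G$ is $\sqsubseteq$-maximal among the proper $\Phi^k$-invariant free factor systems (invariant as sets of conjugacy classes). There is a (unique) automorphism $\varphi$ of $G$ that fixes $G_1$ pointwise and satisfies $\varphi(a)=b g_1$, $\varphi(b)=ba$. Let $\Phi$ be its class in $\mathrm{Out}(G)$ and let $C(\Phi)$ be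 the centraliser of $\Phi$ in $\mathrm{Out}(G,\mathcal O)$ (the relative centraliser). Then: 1. $\Phi$ is IWIP relative to $\mathcal O$. 2. Every $\alpha\in \mathrm{Aut}(G_1)$ with $\alpha(g_1)=g_1$ extends to a factor automorphism $\theta_\alpha$ of $G$ (equal to $\alpha$ on $G_1$ and fixing $a$ and $b$), the class of $\theta_\alpha$ lies in $C(\Phi)$, and $\alpha\mapsto[\theta_\alpha]$ is an injective homomorphism from $\mathrm{Stab}_{\mathrm{Aut}(G_1)}(g_1)$ to $C(\Phi)$. 3. Hence if $\mathrm{Stab}_{\mathrm{Aut}(G_1)}(g_1)$ is not virtually cyclic, then $C(\Phi)$ is not virtually cyclic. 4. If $G_1$ is free with basis $g_1,c,d$, then $C(\Phi)$ contains $\mathrm{Aut}(F_2)\,\mathrm{Inn}(G)/\mathrm{Inn}(G)\cong \mathrm{Aut}(F_2)$, where $\beta\in\mathrm{Aut}(F_2)$ acts on $F_2=\langle c,d\rangle$ and fixes $g_1,a,b$; the map from $\mathrm{Aut}(F_2)$ to $C(\Phi)$ is an injective homomorphism. In particular $C(\Phi)$ is not virtually cyclic. -/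

import Mathlib

open scoped Pointwise

namespace FreeProd

/-- `G` is the internal free product of the family `H` of subgroups: the canonical homomorphism
from the (external) free product of the `H i` to `G` is bijective. -/
def IsInternalFreeProduct {G : Type*} [Group G] {ι : Type*} (H : ι → Subgroup G) : Prop :=
  Function.Bijective (Monoid.CoprodI.lift (fun i => (H i).subtype))

/-- The conjugacy class `[H] = {g H g⁻¹ : g ∈ G}` of a subgroup `H` of `G`. -/
def conjClass {G : Type*} [Group G] (H : Subgroup G) : Set (Subgroup G) :=
  Set.range (fun g : G => MulAut.conj g • H)

/-- A free factor system of `G`: a set `{[H₁], …, [Hₚ]}` of conjugacy classes of non-trivial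
subgroups such that `G = H₁ ∗ ⋯ ∗ Hₚ ∗ F` for some subgroup `F` that is free of finite rank
(possibly of rank `0`). -/
def IsFreeFactorSystem {G : Type*} [Group G] (A : Set (Set (Subgroup G))) : Prop :=
  ∃ (p : ℕ) (H : Fin p → Subgroup G) (F : Subgroup G) (k : ℕ),
    (∀ i, H i ≠ ⊥) ∧
    Nonempty (F ≃* FreeGroup (Fin k)) ∧
    IsInternalFreeProduct (fun i : Option (Fin p) => i.elim F H) ∧
    A = Set.range (fun i => conjClass (H i))

/-- The order `A ⊑ B` on free factor systems: each member of `A` is contained in a conjugate of a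
member of `B`. -/
def Refines {G : Type*} [Group G] (A B : Set (Set (Subgroup G))) : Prop :=
  ∀ c ∈ A, ∃ d ∈ B, ∃ H ∈ c, ∃ K ∈ d, H ≤ K

/-- A free factor system is proper when it is not `{[G]}`. -/
def IsProper {G : Type*} [Group G] (A : Set (Set (Subgroup G))) : Prop :=
  A ≠ {conjClass (⊤ : Subgroup G)}

/-- The group `Inn(G)` of inner automorphisms. -/
def Inn (G : Type*) [Group G] : Subgroup (MulAut G) :=
  (MulAut.conj : G →* MulAut G).range

instance Inn.normal (G : Type*) [Group G] : (Inn G).Normal where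
  conj_mem := by
    rintro _ ⟨g, rfl⟩ φ
    exact ⟨φ g, by ext x; simp [MulAut.mul_apply]⟩

/-- The outer automorphism group `Out(G) = Aut(G) / Inn(G)`. -/
abbrev Out (G : Type*) [Group G] : Type _ := MulAut G ⧸ Inn G

/-- The outer class of an automorphism. -/
def outClass {G : Type*} [Group G] : MulAut G →* Out G := QuotientGroup.mk' (Inn G)

/-- The automorphisms of `G` that preserve the set `A` of conjugacy classes of subgroups. -/
def AutRel {G : Type*} [Group G] (A : Set (Set (Subgroup G))) : Subgroup (MulAut G) :=
  MulAction.stabilizer (MulAut G) A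

/-- The relative outer automorphism group: the image in `Out(G)` of the group of automorphisms that
preserve `A` (that group contains `Inn(G)` because `A` consists of conjugacy classes). For the
free factor system `A = {[G₁], …, [Gₚ]}` of a decomposition `G = G₁ ∗ ⋯ ∗ Gₚ ∗ F` with relative
outer space `𝒪` this is `Out(G, 𝒪)`. -/
def OutRel {G : Type*} [Group G] (A : Set (Set (Subgroup G))) : Subgroup (Out G) :=
  (AutRel A).map outClass

/-- `Φ` is irreducible relative to `A`: `A` is a maximal proper `Φ`-invariant free factor
system. -/
def IsIrreducible {G : Type*} [Group G] (A : Set (Set (Subgroup G))) (Φ : Out G) : Prop :=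
  IsFreeFactorSystem A ∧ IsProper A ∧ Φ ∈ OutRel A ∧
    ∀ B : Set (Set (Subgroup G)), IsFreeFactorSystem B → IsProper B → Φ ∈ OutRel B →
      Refines A B → B = A

/-- `Φ` is IWIP (irreducible with irreducible powers) relative to `A`. -/
def IsIWIP {G : Type*} [Group G] (A : Set (Set (Subgroup G))) (Φ : Out G) : Prop :=
  Φ ∈ OutRel A ∧ ∀ k : ℕ, 1 ≤ k → IsIrreducible A (Φ ^ k)

/-- The relative centraliser: the centraliser of `Φ` in the relative outer automorphism group,
as a subgroup of `Out(G)`. -/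
def relCentraliser {G : Type*} [Group G] (A : Set (Set (Subgroup G))) (Φ : Out G) :
    Subgroup (Out G) :=
  Subgroup.centralizer {Φ} ⊓ OutRel A

/-- A group is virtually cyclic if it has a cyclic subgroup of finite index. -/
def IsVirtuallyCyclic (K : Type*) [Group K] : Prop :=
  ∃ N : Subgroup K, N.FiniteIndex ∧ IsCyclic N

/-- `θ` extends the automorphism `α` of `G₁` to `G = G₁ ∗ ⟨a⟩ ∗ ⟨b⟩` by fixing `a` and `b`, that is,
`θ` is the factor automorphism of `G₁` given by `α`. -/
def IsFactorAut {G : Type*} [Group G] (G₁ : Subgroup G) (a b : G) (α : MulAut G₁)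
    (θ : MulAut G) : Prop :=
  (∀ x : G₁, θ (x : G) = (α x : G)) ∧ θ a = a ∧ θ b = b

end FreeProd

/-! The substance is irreducibility. Take a proper free factor system invariant under a power of `φ`
and above `[G₁]`, conjugated so that `G₁` lies in a member `H o`. Everything is measured by the
retraction `toFree` of `G` onto the free group on `a`, `b`, and by its abelianisation `expSum : G →
ℤ²`. A homomorphism on one factor that kills its part of `G₁` extends to `G` trivially on the other
factors. The extension kills `G₁`, so it is determined by `toFree`, or by `expSum` if the target is
abelian. Hence the images of distinct factors in `ℤ²` are independent, a factor other than `H o`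
with zero image is trivial (`eq_bot_of_expSum`), and `H o` with zero image is `G₁` (`eq_of_expSum`).

On `ℤ²` the twist acts by the Fibonacci matrix, none of whose positive powers has a rational
eigenvector. Some positive power of `φ` preserves each member up to conjugation, so a member with
non-zero image has image of finite rank two, and every other factor has zero image. If that member
is `H o`, the system is `{[G]}`, which is excluded. Otherwise `H o = G₁`, and either there is no
further member, or `G = G₁ ∗ C` with `C` preserved by some `φⁿ` up to conjugation by an element `γ`.

This last case is where `g₁ ≠ 1` enters (`IsTwist.eq_one_of_complement`). Let `ρ : G → G₁` be the
retraction killing `C`, and consider the Fox Jacobian of `φⁿ` over `ℤ[G₁]`. In coordinates adapted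
to `C` it is `ρ γ` times an integral matrix, so every trace of it is one fixed integer times the
trace of `ρ γ`. In the coordinates `a`, `b` its diagonal entries add up to a sum of group elements
with positive signs, one of them `1`. Comparing the augmentation with the coefficient of `1` forces
all these elements to be `1`, and the recursion for `φ` then gives `ρ g₁ = 1`, that is, `g₁ = 1`.

For the centraliser, an extension of `α` commutes with `φ` on generators as soon as `α` fixes `g₁`.
It is inner only through an element commuting with `a` and `b`, which lies in `⟨a⟩ ∩ ⟨b⟩ = 1` by
malnormality. `Aut(F₂)` is not virtually cyclic because positive powers of two opposite
transvections do not commute. -/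

/-! ### Malnormality of the factors of a free product. -/

namespace Monoid.CoprodI

variable {ι : Type*} {M : ι → Type*} [∀ i, Group (M i)]

/-- Every element outside the factor `M i` is, up to multiplication on both sides by elements of
`M i`, given by a nonempty reduced word whose first and last letters are not in `M i`. -/
theorem exists_neWord_of_notMem_range (i : ι) (g : CoprodI M)
    (hg : g ∉ (of : M i →* CoprodI M).range) :
    ∃ (m m' : M i) (j k : ι) (w : NeWord M j k), j ≠ i ∧ k ≠ i ∧ g = of m * w.prod * of m' := by
  classical
  suffices H : ∀ (n : ℕ) (w : Word M), w.toList.length = n →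
      w.prod ∉ (of : M i →* CoprodI M).range →
      ∃ (m m' : M i) (j k : ι) (v : NeWord M j k), j ≠ i ∧ k ≠ i ∧
        w.prod = of m * v.prod * of m' by
    have := H _ (Word.equiv g) rfl
    rw [show (Word.equiv g).prod = g from Word.equiv.symm_apply_apply g] at this
    exact this hg
  intro n
  induction n using Nat.strong_induction_on with
  | _ n ih =>
    intro w hw hr
    have hne : w ≠ Word.empty := by
      rintro rfl
      exact hr (by rw [Word.prod_empty]; exact one_mem _)
    obtain ⟨j, k, v, rfl⟩ := NeWord.of_word w hne
    by_cases hj : j = i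
    · subst hj
      have hh := v.toList_head?
      obtain ⟨l, hl⟩ : ∃ l, v.toList = ⟨j, v.head⟩ :: l := by
        cases hv : v.toList with
        | nil => simp [hv] at hh
        | cons a l => rw [hv] at hh; simp at hh; exact ⟨l, by rw [hh]⟩
      let u : Word M := ⟨l, fun x hx => v.toWord.ne_one x (by
          change x ∈ v.toList; rw [hl]; exact List.mem_cons_of_mem _ hx), by
          have := v.toWord.chain_ne
          change List.IsChain _ v.toList at this
          rw [hl] at this
          exact this.tail⟩
      have hp : v.toWord.prod = of v.head * u.prod := by
        simp only [Word.prod, NeWord.toWord, hl, u]; simp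
      obtain ⟨m, m', a, b, t, ha, hb, ht⟩ := ih u.toList.length (by
          rw [← hw]; change l.length < v.toList.length; rw [hl]; simp) u rfl (by
          intro h
          apply hr
          rw [hp]
          exact mul_mem ⟨_, rfl⟩ h)
      exact ⟨v.head * m, m', a, b, t, ha, hb, by rw [hp, ht]; simp [mul_assoc]⟩
    by_cases hk : k = i
    · subst hk
      have hh := v.toList_getLast?
      obtain ⟨l, hl⟩ : ∃ l, v.toList = l ++ [⟨k, v.last⟩] := by
        rw [List.getLast?_eq_some_iff] at hh
        exact hh
      let u : Word M := ⟨l, fun x hx => v.toWord.ne_one x (by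
          change x ∈ v.toList; rw [hl]; exact List.mem_append_left _ hx), by
          have := v.toWord.chain_ne
          change List.IsChain _ v.toList at this
          rw [hl] at this
          exact this.left_of_append⟩
      have hp : v.toWord.prod = u.prod * of v.last := by
        simp only [Word.prod, NeWord.toWord, hl, u]; simp
      obtain ⟨m, m', a, b, t, ha, hb, ht⟩ := ih u.toList.length (by
          rw [← hw]; change l.length < v.toList.length; rw [hl]; simp) u rfl (by
          intro h
          apply hr
          rw [hp]
          exact mul_mem h ⟨_, rfl⟩)
      exact ⟨m, m' * v.last, a, b, t, ha, hb, by rw [hp, ht]; simp [mul_assoc]⟩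
    exact ⟨1, 1, j, k, v, hj, hk, by simp [NeWord.prod]⟩

theorem NeWord.two_le_length_of_append {i j k l : ι} (w₁ : NeWord M i j) (h : j ≠ k)
    (w₂ : NeWord M k l) : 2 ≤ (NeWord.append w₁ h w₂).toList.length := by
  have h₁ := List.length_pos_of_ne_nil w₁.toList_ne_nil
  have h₂ := List.length_pos_of_ne_nil w₂.toList_ne_nil
  simp only [NeWord.toList, List.length_append]
  omega

theorem NeWord.prod_notMem_range_of_two_le {j k : ι} (w : NeWord M j k)
    (hw : 2 ≤ w.toList.length) (i : ι) : w.prod ∉ (of : M i →* CoprodI M).range := by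
  classical
  rintro ⟨y, hy⟩
  by_cases h1 : y = 1
  · subst h1
    have : w.toWord = Word.empty := Word.equiv.symm.injective (by
      change w.toWord.prod = Word.prod Word.empty
      rw [Word.prod_empty, ← map_one (of (i := i))]; exact hy.symm)
    have h2 := congrArg (fun u => u.toList.length) this
    change w.toList.length = 0 at h2
    omega
  · have : w.toWord = (NeWord.singleton y h1).toWord := Word.equiv.symm.injective (by
      change w.prod = (NeWord.singleton y h1).prod
      rw [NeWord.prod_singleton, hy])
    have h2 := congrArg (fun u => u.toList.length) this
    change w.toList.length = 1 at h2
    omega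

/-- The factors of a free product are malnormal. -/
theorem mem_range_of_of_conj_mem_range {i : ι} {g : CoprodI M} {x : M i} (hx : x ≠ 1)
    (h : g * of x * g⁻¹ ∈ (of : M i →* CoprodI M).range) :
    g ∈ (of : M i →* CoprodI M).range := by
  by_contra hg
  obtain ⟨m, m', j, k, w, hj, hk, rfl⟩ := exists_neWord_of_notMem_range i g hg
  have hx' : m' * x * m'⁻¹ ≠ 1 := by simpa [mul_inv_eq_one] using hx
  -- Since `w` starts and ends outside `M i`, inserting a letter of `M i` between `w` and its
  -- inverse leaves a reduced word.
  let v := NeWord.append (NeWord.append w hk (NeWord.singleton _ hx')) hk.symm w.inv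
  refine v.prod_notMem_range_of_two_le (NeWord.two_le_length_of_append _ _ _) i ?_
  have : v.prod = (of m)⁻¹ * (of m * w.prod * of m' * of x * (of m * w.prod * of m')⁻¹) * of m := by
    simp [v, mul_assoc]
  rw [this]
  exact mul_mem (mul_mem (inv_mem ⟨_, rfl⟩) h) ⟨_, rfl⟩

end Monoid.CoprodI

/-! ### Internal free products of subgroups. -/

namespace FreeProd

section Internal

variable {G : Type*} [Group G] {ι : Type*} {H : ι → Subgroup G}

/-- The embedding of a subgroup of a family in the external free product of the family. -/
abbrev factorOf (H : ι → Subgroup G) (i : ι) : H i →* Monoid.CoprodI (fun i => H i) :=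
  Monoid.CoprodI.of (M := fun i => H i)

theorem IsInternalFreeProduct.exists_extension (h : IsInternalFreeProduct H) {K : Type*} [Group K]
    (f : ∀ i, H i →* K) : ∃ ψ : G →* K, ∀ i (x : H i), ψ x = f i x := by
  let e := MulEquiv.ofBijective _ h
  refine ⟨(Monoid.CoprodI.lift f).comp e.symm.toMonoidHom, fun i x => ?_⟩
  have : e.symm (x : G) = factorOf H i x := by
    rw [MulEquiv.symm_apply_eq]; exact (Monoid.CoprodI.lift_of (fun i => (H i).subtype) x).symm
  simp [this]

theorem IsInternalFreeProduct.hom_ext (h : IsInternalFreeProduct H) {K : Type*} [Group K]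
    {ψ χ : G →* K} (hf : ∀ i (x : H i), ψ x = χ x) : ψ = χ := by
  have : ψ.comp (Monoid.CoprodI.lift (fun i => (H i).subtype)) =
      χ.comp (Monoid.CoprodI.lift (fun i => (H i).subtype)) := by
    apply Monoid.CoprodI.ext_hom
    intro i
    ext x
    simp [hf]
  exact (MonoidHom.cancel_right h.2).1 this

theorem IsInternalFreeProduct.iSup_eq_top (h : IsInternalFreeProduct H) : ⨆ i, H i = ⊤ := by
  have := Monoid.CoprodI.range_eq_iSup (G := fun i => H i) (fun i => (H i).subtype)
  rw [MonoidHom.range_eq_top.2 h.2] at this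
  simpa using this.symm

theorem isInternalFreeProduct_of_exists (hsup : ⨆ i, H i = ⊤)
    (hex : ∃ ψ : G →* Monoid.CoprodI (fun i => H i),
      ∀ i (x : H i), ψ x = factorOf H i x) : IsInternalFreeProduct H := by
  obtain ⟨ψ, hψ⟩ := hex
  constructor
  · apply Function.LeftInverse.injective (g := ψ)
    intro x
    have : ψ.comp (Monoid.CoprodI.lift (fun i => (H i).subtype)) = MonoidHom.id _ := by
      apply Monoid.CoprodI.ext_hom
      intro i
      ext x
      simp [hψ]
    exact DFunLike.congr_fun this x
  · rw [← MonoidHom.range_eq_top, Monoid.CoprodI.range_eq_iSup]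
    simpa using hsup

theorem IsInternalFreeProduct.mem_of_conj_mem (h : IsInternalFreeProduct H) {i : ι} {g x : G}
    (hx : x ∈ H i) (hx1 : x ≠ 1) (hc : g * x * g⁻¹ ∈ H i) : g ∈ H i := by
  let e := MulEquiv.ofBijective _ h
  have he : ∀ y : H i, e (factorOf H i y) = (y : G) := fun y =>
    Monoid.CoprodI.lift_of _ _
  have hs : ∀ y (hy : y ∈ H i), e.symm y = factorOf H i ⟨y, hy⟩ := fun y hy => by
    rw [MulEquiv.symm_apply_eq, he]
  have : e.symm g ∈ (factorOf H i).range := by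
    apply Monoid.CoprodI.mem_range_of_of_conj_mem_range (M := fun i => H i) (x := ⟨x, hx⟩)
    · simpa [Subtype.ext_iff] using hx1
    · refine ⟨⟨_, hc⟩, ?_⟩
      rw [← hs, ← hs]
      simp
  obtain ⟨y, hy⟩ := this
  have := congrArg e hy
  rw [he, MulEquiv.apply_symm_apply] at this
  rw [← this]
  exact y.2

theorem IsInternalFreeProduct.eq_one_of_mem_of_mem (h : IsInternalFreeProduct H) {i j : ι}
    (hij : i ≠ j) {x : G} (hi : x ∈ H i) (hj : x ∈ H j) : x = 1 := by
  classical
  obtain ⟨ψ, hψ⟩ := h.exists_extension (K := G)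
    (fun k => if k = i then (H k).subtype else 1)
  have h1 := hψ i ⟨x, hi⟩
  have h2 := hψ j ⟨x, hj⟩
  simp only [if_true, if_neg hij.symm] at h1 h2
  simpa [h1] using h2

theorem IsInternalFreeProduct.smul (h : IsInternalFreeProduct H) (θ : MulAut G) :
    IsInternalFreeProduct (fun i => θ • H i) := by
  have hmem : ∀ i (x : ((θ • H i : Subgroup G))), θ.symm x ∈ H i := fun i x => by
    obtain ⟨y, hy, hyx⟩ := x.2
    rw [← hyx]
    change θ.symm (θ y) ∈ H i
    rw [MulEquiv.symm_apply_apply]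
    exact hy
  apply isInternalFreeProduct_of_exists
  · rw [eq_top_iff]
    intro g _
    have : θ.symm g ∈ ⨆ i, H i := by rw [h.iSup_eq_top]; trivial
    have h2 : (⨆ i, H i) ≤ (⨆ i, (θ • H i : Subgroup G)).comap θ.toMonoidHom := by
      refine iSup_le fun i => ?_
      intro x hx
      rw [Subgroup.mem_comap]
      exact Subgroup.mem_iSup_of_mem (S := fun i => (θ • H i : Subgroup G)) i
        (Subgroup.smul_mem_pointwise_smul x θ (H i) hx)
    have h3 : θ (θ.symm g) ∈ ⨆ i, (θ • H i : Subgroup G) := h2 this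
    rwa [MulEquiv.apply_symm_apply] at h3
  · obtain ⟨ψ, hψ⟩ := h.exists_extension
      (K := Monoid.CoprodI (fun i => (θ • H i : Subgroup G)))
      (fun i => (factorOf (fun i => θ • H i) i).comp
        ((θ.toMonoidHom.comp (H i).subtype).codRestrict (θ • H i) (fun x => ⟨x, x.2, rfl⟩)))
    refine ⟨ψ.comp θ.symm.toMonoidHom, fun i x => ?_⟩
    have := hψ i ⟨θ.symm x, hmem i x⟩
    simp only [MonoidHom.comp_apply] at this ⊢
    refine this.trans ?_
    congr 1
    exact Subtype.ext (θ.apply_symm_apply x)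

end Internal

end FreeProd

/-! ### The splitting, its exponent sums and the twist. -/

namespace FreeProd

/-- `G` is the internal free product of `G₁` and of the infinite cyclic groups generated by `a`
and `b`. -/
structure IsFreeSplitting {G : Type*} [Group G] (G₁ : Subgroup G) (a b : G) : Prop where
  orderOf_left : orderOf a = 0
  orderOf_right : orderOf b = 0
  isInternal : IsInternalFreeProduct
    (![G₁, Subgroup.zpowers a, Subgroup.zpowers b] : Fin 3 → Subgroup G)

theorem exists_hom_zpowers {G K : Type*} [Group G] [Group K] {a : G} (ha : orderOf a = 0) (x : K) :
    ∃ f : Subgroup.zpowers a →* K, f ⟨a, Subgroup.mem_zpowers a⟩ = x := by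
  have hinj : Function.Injective (zpowersHom G a) := by
    intro m n hmn
    simp only [zpowersHom_apply] at hmn
    exact injective_zpow_iff_not_isOfFinOrder.2 (orderOf_eq_zero_iff.1 ha) hmn
  have hr : (zpowersHom G a).range = Subgroup.zpowers a := by
    ext g
    simp only [MonoidHom.mem_range, zpowersHom_apply, Subgroup.mem_zpowers_iff]
    exact ⟨fun ⟨n, hn⟩ => ⟨n.toAdd, hn⟩, fun ⟨n, hn⟩ => ⟨Multiplicative.ofAdd n, hn⟩⟩
  let e : Multiplicative ℤ ≃* Subgroup.zpowers a :=
    (MonoidHom.ofInjective hinj).trans (MulEquiv.subgroupCongr hr)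
  refine ⟨(zpowersHom K x).comp e.symm.toMonoidHom, ?_⟩
  have : e.symm ⟨a, Subgroup.mem_zpowers a⟩ = Multiplicative.ofAdd 1 := by
    rw [MulEquiv.symm_apply_eq]
    exact Subtype.ext (zpow_one a).symm
  simp [this]

namespace IsFreeSplitting

variable {G : Type*} [Group G] {G₁ : Subgroup G} {a b : G}

theorem exists_extension (h : IsFreeSplitting G₁ a b) {K : Type*} [Group K] (f : G₁ →* K)
    (x y : K) : ∃ ψ : G →* K, (∀ g : G₁, ψ g = f g) ∧ ψ a = x ∧ ψ b = y := by
  obtain ⟨fa, hfa⟩ := exists_hom_zpowers h.orderOf_left x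
  obtain ⟨fb, hfb⟩ := exists_hom_zpowers h.orderOf_right y
  obtain ⟨ψ, hψ⟩ := h.isInternal.exists_extension (K := K)
    (Fin.cons f (Fin.cons fa (Fin.cons fb finZeroElim)))
  refine ⟨ψ, fun g => hψ 0 g, ?_, ?_⟩
  · rw [← hfa]; exact hψ 1 ⟨a, Subgroup.mem_zpowers a⟩
  · rw [← hfb]; exact hψ 2 ⟨b, Subgroup.mem_zpowers b⟩

theorem hom_ext (h : IsFreeSplitting G₁ a b) {K : Type*} [Group K] {ψ χ : G →* K}
    (h₁ : ∀ g ∈ G₁, ψ g = χ g) (ha : ψ a = χ a) (hb : ψ b = χ b) : ψ = χ := by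
  apply h.isInternal.hom_ext
  intro i
  fin_cases i
  · exact fun x => h₁ x x.2
  · rintro ⟨_, n, rfl⟩
    simp [ha]
  · rintro ⟨_, n, rfl⟩
    simp [hb]

theorem eq_top_of_le (h : IsFreeSplitting G₁ a b) {S : Subgroup G} (h₁ : G₁ ≤ S) (ha : a ∈ S)
    (hb : b ∈ S) : S = ⊤ := by
  rw [eq_top_iff, ← h.isInternal.iSup_eq_top]
  refine iSup_le fun i => ?_
  fin_cases i
  · exact h₁
  · exact (Subgroup.zpowers_le).2 ha
  · exact (Subgroup.zpowers_le).2 hb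

theorem closure_eq_top (h : IsFreeSplitting G₁ a b) :
    Subgroup.closure ((G₁ : Set G) ∪ {a, b}) = ⊤ :=
  h.eq_top_of_le (fun _ hx => Subgroup.subset_closure (Or.inl hx))
    (Subgroup.subset_closure (by simp)) (Subgroup.subset_closure (by simp))

theorem left_ne_one (h : IsFreeSplitting G₁ a b) : a ≠ 1 := by
  rintro rfl
  simpa using h.orderOf_left

theorem right_ne_one (h : IsFreeSplitting G₁ a b) : b ≠ 1 := by
  rintro rfl
  simpa using h.orderOf_right

theorem eq_one_of_commute (h : IsFreeSplitting G₁ a b) {g : G} (ha : g * a * g⁻¹ = a)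
    (hb : g * b * g⁻¹ = b) : g = 1 := by
  have h1 : g ∈ Subgroup.zpowers a :=
    h.isInternal.mem_of_conj_mem (i := 1) (x := a) (Subgroup.mem_zpowers a) h.left_ne_one
      (by rw [ha]; exact Subgroup.mem_zpowers a)
  have h2 : g ∈ Subgroup.zpowers b :=
    h.isInternal.mem_of_conj_mem (i := 2) (x := b) (Subgroup.mem_zpowers b) h.right_ne_one
      (by rw [hb]; exact Subgroup.mem_zpowers b)
  exact h.isInternal.eq_one_of_mem_of_mem (i := 1) (j := 2) (by decide) h1 h2

/-- The retraction of `G = G₁ ∗ ⟨a⟩ ∗ ⟨b⟩` onto the free group on `a` and `b`, with kernel the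
normal closure of `G₁`. -/
noncomputable def toFree (h : IsFreeSplitting G₁ a b) : G →* FreeGroup (Fin 2) :=
  (h.exists_extension 1 (FreeGroup.of 0) (FreeGroup.of 1)).choose

theorem toFree_of_mem (h : IsFreeSplitting G₁ a b) {g : G} (hg : g ∈ G₁) : h.toFree g = 1 :=
  (h.exists_extension 1 (FreeGroup.of 0) (FreeGroup.of 1)).choose_spec.1 ⟨g, hg⟩

theorem toFree_left (h : IsFreeSplitting G₁ a b) : h.toFree a = FreeGroup.of 0 :=
  (h.exists_extension 1 (FreeGroup.of 0) (FreeGroup.of 1)).choose_spec.2.1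

theorem toFree_right (h : IsFreeSplitting G₁ a b) : h.toFree b = FreeGroup.of 1 :=
  (h.exists_extension 1 (FreeGroup.of 0) (FreeGroup.of 1)).choose_spec.2.2

theorem hom_eq_lift_toFree (h : IsFreeSplitting G₁ a b) {K : Type*} [Group K] (χ : G →* K)
    (hχ : ∀ g ∈ G₁, χ g = 1) (g : G) : χ g = FreeGroup.lift ![χ a, χ b] (h.toFree g) := by
  have : χ = (FreeGroup.lift ![χ a, χ b]).comp h.toFree := by
    apply h.hom_ext
    · intro g hg
      simp [hχ g hg, h.toFree_of_mem hg]
    · simp [h.toFree_left]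
    · simp [h.toFree_right]
  exact DFunLike.congr_fun this g

theorem lift_toFree_lift (h : IsFreeSplitting G₁ a b) (w : FreeGroup (Fin 2)) :
    h.toFree (FreeGroup.lift ![a, b] w) = w := by
  have : h.toFree.comp (FreeGroup.lift ![a, b]) = MonoidHom.id _ := by
    ext i
    fin_cases i
    · simp [h.toFree_left]
    · simp [h.toFree_right]
  exact DFunLike.congr_fun this w

/-- The exponent sums of `a` and `b`. -/
noncomputable def expSum (h : IsFreeSplitting G₁ a b) : G →* Multiplicative (ℤ × ℤ) :=
  (h.exists_extension 1 (Multiplicative.ofAdd (1, 0)) (Multiplicative.ofAdd (0, 1))).choose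

theorem expSum_of_mem (h : IsFreeSplitting G₁ a b) {g : G} (hg : g ∈ G₁) : h.expSum g = 1 :=
  (h.exists_extension 1 (Multiplicative.ofAdd ((1, 0) : ℤ × ℤ))
    (Multiplicative.ofAdd (0, 1))).choose_spec.1 ⟨g, hg⟩

theorem expSum_left (h : IsFreeSplitting G₁ a b) : h.expSum a = Multiplicative.ofAdd (1, 0) :=
  (h.exists_extension 1 (Multiplicative.ofAdd ((1, 0) : ℤ × ℤ))
    (Multiplicative.ofAdd (0, 1))).choose_spec.2.1

theorem expSum_right (h : IsFreeSplitting G₁ a b) : h.expSum b = Multiplicative.ofAdd (0, 1) :=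
  (h.exists_extension 1 (Multiplicative.ofAdd ((1, 0) : ℤ × ℤ))
    (Multiplicative.ofAdd (0, 1))).choose_spec.2.2

theorem hom_eq_expSum (h : IsFreeSplitting G₁ a b) {K : Type*} [CommGroup K] (χ : G →* K)
    (hχ : ∀ g ∈ G₁, χ g = 1) (g : G) :
    χ g = χ a ^ (h.expSum g).toAdd.1 * χ b ^ (h.expSum g).toAdd.2 := by
  let e : Multiplicative (ℤ × ℤ) →* K :=
    { toFun := fun z => χ a ^ z.toAdd.1 * χ b ^ z.toAdd.2
      map_one' := by simp
      map_mul' := fun x y => by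
        simp only [toAdd_mul, Prod.fst_add, Prod.snd_add, zpow_add]
        exact mul_mul_mul_comm _ _ _ _ }
  have : χ = e.comp h.expSum := by
    apply h.hom_ext
    · intro g hg
      simp [hχ g hg, h.expSum_of_mem hg]
    · simp [h.expSum_left, e]
    · simp [h.expSum_right, e]
  exact DFunLike.congr_fun this g

theorem expSum_eq_of_toFree_eq (h : IsFreeSplitting G₁ a b) {g g' : G}
    (hg : h.toFree g = h.toFree g') : h.expSum g = h.expSum g' := by
  rw [h.hom_eq_lift_toFree h.expSum (fun _ => h.expSum_of_mem) g, hg,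
    ← h.hom_eq_lift_toFree h.expSum (fun _ => h.expSum_of_mem) g']

/-- The data of the automorphism fixing `G₁` and mapping `a` to `b g₁` and `b` to `b a`. -/
structure IsTwist (G₁ : Subgroup G) (a b g₁ : G) (φ : MulAut G) : Prop where
  map_mem : ∀ x ∈ G₁, φ x = x
  map_left : φ a = b * g₁
  map_right : φ b = b * a

theorem exists_isTwist (h : IsFreeSplitting G₁ a b) {g₁ : G} (hg : g₁ ∈ G₁) :
    ∃ φ : MulAut G, IsTwist G₁ a b g₁ φ := by
  obtain ⟨f, hf, hfa, hfb⟩ := h.exists_extension G₁.subtype (b * g₁) (b * a)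
  -- The inverse: solve `φ a = b g₁` for `b`, then `φ b = b a` for `a`.
  obtain ⟨f', hf', hfa', hfb'⟩ := h.exists_extension G₁.subtype (g₁ * a⁻¹ * b) (a * g₁⁻¹)
  have e1 : f g₁ = g₁ := hf ⟨g₁, hg⟩
  have e2 : f' g₁ = g₁ := hf' ⟨g₁, hg⟩
  refine ⟨MonoidHom.toMulEquiv f f' ?_ ?_, ?_, hfa, hfb⟩
  · apply h.hom_ext
    · intro g hg
      simp [show f g = g from hf ⟨g, hg⟩, show f' g = g from hf' ⟨g, hg⟩]
    · simp [hfa, hfb', e2]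
    · simp [hfb, hfa', hfb', mul_assoc]
  · apply h.hom_ext
    · intro g hg
      simp [show f g = g from hf ⟨g, hg⟩, show f' g = g from hf' ⟨g, hg⟩]
    · simp [hfa', hfa, hfb, e1]
    · simp [hfa, hfb', e1]
  · intro x hx
    exact hf ⟨x, hx⟩

variable {g₁ : G} {φ : MulAut G}

theorem IsTwist.pow_map_mem (hφ : IsTwist G₁ a b g₁ φ) (n : ℕ) {x : G} (hx : x ∈ G₁) :
    (φ ^ n) x = x := by
  induction n with
  | zero => simp
  | succ n ih => rw [pow_succ, MulAut.mul_apply, hφ.map_mem x hx, ih]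

theorem IsTwist.expSum_map (hφ : IsTwist G₁ a b g₁ φ) (h : IsFreeSplitting G₁ a b) (hg : g₁ ∈ G₁)
    (g : G) : h.expSum (φ g) = Multiplicative.ofAdd
      ((h.expSum g).toAdd.2, (h.expSum g).toAdd.1 + (h.expSum g).toAdd.2) := by
  rw [← MulEquiv.coe_toMonoidHom, ← MonoidHom.comp_apply,
    h.hom_eq_expSum (h.expSum.comp φ.toMonoidHom)]
  · have ha : (h.expSum.comp φ.toMonoidHom) a = Multiplicative.ofAdd (0, 1) := by
      simp [hφ.map_left, h.expSum_right, h.expSum_of_mem hg]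
    have hb : (h.expSum.comp φ.toMonoidHom) b = Multiplicative.ofAdd (1, 1) := by
      simp [hφ.map_right, h.expSum_right, h.expSum_left, ← ofAdd_add]
    rw [ha, hb, ← ofAdd_zsmul, ← ofAdd_zsmul, ← ofAdd_add]
    simp
  · intro x hx
    simp [hφ.map_mem x hx, h.expSum_of_mem hx]

/-- The matrix `M` of the twist satisfies `M² = M + 1`, so `M ^ (n + 1) = fib n + fib (n + 1) * M`.
-/
theorem IsTwist.expSum_pow_map (hφ : IsTwist G₁ a b g₁ φ) (h : IsFreeSplitting G₁ a b)
    (hg : g₁ ∈ G₁) (n : ℕ) (g : G) {s t : ℤ} (hst : h.expSum g = Multiplicative.ofAdd (s, t)) :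
    h.expSum ((φ ^ (n + 1)) g) = Multiplicative.ofAdd
      (Nat.fib n * s + Nat.fib (n + 1) * t, Nat.fib (n + 1) * s + Nat.fib (n + 2) * t) := by
  induction n with
  | zero => simp [hφ.expSum_map h hg, hst]
  | succ n ih =>
    rw [pow_succ', MulAut.mul_apply, hφ.expSum_map h hg, ih]
    congr 1
    have : Nat.fib (n + 1 + 2) = Nat.fib (n + 1) + Nat.fib (n + 2) := Nat.fib_add_two
    rw [this, show n + 1 + 1 = n + 2 from rfl, Nat.fib_add_two (n := n)]
    simp only [toAdd_ofAdd, Prod.mk.injEq]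
    constructor
    · push_cast
    · push_cast
      ring

end IsFreeSplitting

/-- The form is the determinant of a vector and its image under the Fibonacci matrix. Its
discriminant is `5`, so an integral zero would make `√5` rational. -/
theorem sq_add_mul_sub_sq_ne_zero {s t : ℤ} (h : (s, t) ≠ 0) : s ^ 2 + s * t - t ^ 2 ≠ 0 := by
  intro h0
  have h5 : Irrational (√5 : ℝ) := by
    have := Nat.Prime.irrational_sqrt (p := 5) (by norm_num)
    exact_mod_cast this
  by_cases ht : t = 0
  · subst ht
    apply h
    simpa using h0
  · apply h5
    refine ⟨|((2 * s + t : ℤ) : ℚ) / t|, ?_⟩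
    have ht' : (t : ℝ) ≠ 0 := by exact_mod_cast ht
    have h0' : (s : ℝ) ^ 2 + s * t - t ^ 2 = 0 := by exact_mod_cast h0
    symm
    rw [Real.sqrt_eq_iff_mul_self_eq (by norm_num) (by positivity)]
    push_cast
    rw [abs_mul_abs_self]
    field_simp
    linear_combination -4 * h0'

end FreeProd

/-! ### Free factors seen through exponent sums. -/

namespace FreeProd

theorem IsInternalFreeProduct.exists_extension_single {G : Type*} [Group G] {ι : Type*}
    {H : ι → Subgroup G} (hH : IsInternalFreeProduct H) {K : Type*} [Group K] (i : ι)
    (f : H i →* K) :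
    ∃ ψ : G →* K, (∀ x : H i, ψ x = f x) ∧ ∀ j, j ≠ i → ∀ x ∈ H j, ψ x = 1 := by
  classical
  obtain ⟨ψ, hψ⟩ := hH.exists_extension (K := K) (fun j => if h : j = i then h ▸ f else 1)
  refine ⟨ψ, fun x => ?_, fun j hj x hx => ?_⟩
  · simpa using hψ i x
  · simpa [hj] using hψ j ⟨x, hx⟩

namespace IsFreeSplitting

variable {G : Type*} [Group G] {G₁ : Subgroup G} {a b : G} {ι : Type*} {H : ι → Subgroup G} {o : ι}

/-- The point is the last conclusion: as `ψ` kills `G₁`, it is determined by its values at `a` and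
`b`. If `i ≠ o`, the whole factor containing `G₁` is killed. -/
theorem exists_extension_single (hH : IsInternalFreeProduct H) (ho : G₁ ≤ H o) {K : Type*}
    [Group K] (i : ι) (f : H i →* K) (hf : ∀ x : H i, (x : G) ∈ G₁ → f x = 1) :
    ∃ ψ : G →* K, (∀ x : H i, ψ x = f x) ∧ (∀ j, j ≠ i → ∀ x ∈ H j, ψ x = 1) ∧
      ∀ x ∈ G₁, ψ x = 1 := by
  obtain ⟨ψ, h1, h2⟩ := hH.exists_extension_single i f
  refine ⟨ψ, h1, h2, fun x hx => ?_⟩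
  by_cases hi : o = i
  · subst hi
    rw [← hf ⟨x, ho hx⟩ hx]
    exact h1 ⟨x, ho hx⟩
  · exact h2 o hi x (ho hx)

theorem expSum_eq_one_of_eq (h : IsFreeSplitting G₁ a b) (hH : IsInternalFreeProduct H)
    (ho : G₁ ≤ H o) {i j : ι} (hij : i ≠ j) {x y : G} (hx : x ∈ H i) (hy : y ∈ H j)
    (hxy : h.expSum x = h.expSum y) : h.expSum x = 1 := by
  obtain ⟨ψ, h1, h2, h3⟩ := exists_extension_single hH ho i (h.expSum.comp (H i).subtype)
    (fun x hx => h.expSum_of_mem hx)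
  have hx' : ψ x = h.expSum x := h1 ⟨x, hx⟩
  rw [← hx', h.hom_eq_expSum ψ h3, hxy, ← h.hom_eq_expSum ψ h3, h2 j hij.symm y hy]

/-- The image is free by Nielsen–Schreier, so if non-trivial it maps onto `ℤ`. The composite extends
to a homomorphism on `G` that kills `G₁`, hence factors through `expSum` and vanishes on `H i`. -/
theorem hom_eq_one_of_expSum (h : IsFreeSplitting G₁ a b) (hH : IsInternalFreeProduct H)
    (ho : G₁ ≤ H o) {i : ι} (hi : ∀ x ∈ H i, h.expSum x = 1) {K : Type*} [Group K]
    [IsFreeGroup K] (χ : H i →* K) (hχ : ∀ x : H i, (x : G) ∈ G₁ → χ x = 1) (x : H i) :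
    χ x = 1 := by
  have : IsFreeGroup χ.range := subgroupIsFreeOfIsFree χ.range
  by_cases he : IsEmpty (IsFreeGroup.Generators χ.range)
  · have h1 := IsFreeGroup.ext_hom (G := χ.range) (f := MonoidHom.id _) (g := 1)
      (fun e => he.elim e)
    have h2 := DFunLike.congr_fun h1 ⟨χ x, x, rfl⟩
    simpa [Subtype.ext_iff] using h2
  · obtain ⟨e⟩ := not_isEmpty_iff.1 he
    exfalso
    let ε : χ.range →* Multiplicative ℤ := IsFreeGroup.lift (fun _ => Multiplicative.ofAdd 1)
    have hε : ε (IsFreeGroup.of e) = Multiplicative.ofAdd 1 := IsFreeGroup.lift_of _ _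
    obtain ⟨ψ, h1, -, h3⟩ := exists_extension_single hH ho i (ε.comp χ.rangeRestrict) (by
      intro x hx
      have : χ.rangeRestrict x = 1 := Subtype.ext (hχ x hx)
      simp [this])
    obtain ⟨y, hy⟩ := χ.rangeRestrict_surjective (IsFreeGroup.of e)
    have h4 := h1 y
    rw [MonoidHom.comp_apply, hy, hε, h.hom_eq_expSum ψ h3, hi y y.2] at h4
    simp at h4
    exact absurd (congrArg Multiplicative.toAdd h4) (by simp)

/-- The projection of `G` onto `H i` kills `G₁`, so it factors through `toFree`, yet it is the
identity on `H i`. -/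
theorem eq_one_of_toFree_eq_one (h : IsFreeSplitting G₁ a b) (hH : IsInternalFreeProduct H)
    (ho : G₁ ≤ H o) {i : ι} (hi : i ≠ o) {x : G} (hx : x ∈ H i) (hq : h.toFree x = 1) :
    x = 1 := by
  obtain ⟨ψ, h1, -, h3⟩ := exists_extension_single hH ho i (MonoidHom.id (H i)) (by
    intro y hy
    exact Subtype.ext (hH.eq_one_of_mem_of_mem hi y.2 (ho hy)))
  have h4 := h1 ⟨x, hx⟩
  rw [h.hom_eq_lift_toFree ψ h3, hq] at h4
  simpa [Subtype.ext_iff] using h4.symm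

theorem eq_bot_of_expSum (h : IsFreeSplitting G₁ a b) (hH : IsInternalFreeProduct H)
    (ho : G₁ ≤ H o) {i : ι} (hio : i ≠ o) (hi : ∀ x ∈ H i, h.expSum x = 1) : H i = ⊥ := by
  rw [Subgroup.eq_bot_iff_forall]
  intro x hx
  refine h.eq_one_of_toFree_eq_one hH ho hio hx ?_
  exact h.hom_eq_one_of_expSum hH ho hi (h.toFree.comp (H i).subtype)
    (fun y hy => h.toFree_of_mem hy) ⟨x, hx⟩

/-- The element spelled by a list of pairs, the first components being words in `a` and `b` and
the second ones elements of `G₁`. -/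
def pairProd (a b : G) (l : List (FreeGroup (Fin 2) × G₁)) : G :=
  (l.map (fun p => FreeGroup.lift ![a, b] p.1 * (p.2 : G))).prod

@[simp] theorem pairProd_nil : pairProd a b ([] : List (FreeGroup (Fin 2) × G₁)) = 1 := rfl

@[simp] theorem pairProd_cons (p : FreeGroup (Fin 2) × G₁) (l : List (FreeGroup (Fin 2) × G₁)) :
    pairProd a b (p :: l) = FreeGroup.lift ![a, b] p.1 * (p.2 : G) * pairProd a b l := by
  simp [pairProd]

@[simp] theorem pairProd_append (l l' : List (FreeGroup (Fin 2) × G₁)) :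
    pairProd a b (l ++ l') = pairProd a b l * pairProd a b l' := by
  simp [pairProd]

theorem exists_pairProd_eq (h : IsFreeSplitting G₁ a b) (g : G) :
    ∃ l : List (FreeGroup (Fin 2) × G₁), pairProd a b l = g := by
  have hg : g ∈ Subgroup.closure ((G₁ : Set G) ∪ {a, b}) := by
    rw [h.closure_eq_top]; trivial
  induction hg using Subgroup.closure_induction_right with
  | one => exact ⟨[], rfl⟩
  | mul_right x hx y hy ih =>
    obtain ⟨l, rfl⟩ := ih
    rcases hy with hy | rfl | rfl
    · exact ⟨l ++ [(1, ⟨y, hy⟩)], by simp⟩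
    · exact ⟨l ++ [(FreeGroup.of 0, 1)], by simp⟩
    · exact ⟨l ++ [(FreeGroup.of 1, 1)], by simp⟩
  | mul_inv_cancel x hx y hy ih =>
    obtain ⟨l, rfl⟩ := ih
    rcases hy with hy | rfl | rfl
    · exact ⟨l ++ [(1, ⟨y, hy⟩⁻¹)], by simp⟩
    · exact ⟨l ++ [((FreeGroup.of 0)⁻¹, 1)], by simp⟩
    · exact ⟨l ++ [((FreeGroup.of 1)⁻¹, 1)], by simp⟩

/-- The free cocycle: for every `G`-set `Y` and base point `y` there are elements `c g` of the free
group on `Y` that satisfy the cocycle rule, are trivial along `G₁`, and are equal to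
`[y]⁻¹ [y f]` along the subgroup generated by `a` and `b`, where `y g = g⁻¹ • y`. -/
theorem exists_free_cocycle (h : IsFreeSplitting G₁ a b) (Y : Type*) [MulAction G Y] :
    ∃ c : Y → G → FreeGroup Y,
      (∀ y g g', c y (g * g') = c y g * c (g⁻¹ • y) g') ∧
      (∀ y, ∀ g ∈ G₁, c y g = 1) ∧
      ∀ y w, c y (FreeGroup.lift ![a, b] w) =
        (FreeGroup.of y)⁻¹ * FreeGroup.of ((FreeGroup.lift ![a, b] w)⁻¹ • y) := by
  let act : G →* MulAut (Y → FreeGroup Y) :=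
    letI := arrowMulDistribMulAction (G := G) (A := Y) (M := FreeGroup Y)
    MulDistribMulAction.toMulAut G (Y → FreeGroup Y)
  have hact : ∀ g (f : Y → FreeGroup Y) y, act g f y = f (g⁻¹ • y) := fun _ _ _ => rfl
  -- Conjugating the inclusion of `⟨a, b⟩` by `κ`, while leaving that of `G₁` alone, makes the
  -- cocycle a coboundary on `⟨a, b⟩` and trivial on `G₁`.
  let κ : (Y → FreeGroup Y) ⋊[act] G := SemidirectProduct.inl (fun y => (FreeGroup.of y)⁻¹)
  obtain ⟨Ψ, h1, ha, hb⟩ := h.exists_extension (K := (Y → FreeGroup Y) ⋊[act] G)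
    (SemidirectProduct.inr.comp G₁.subtype) (κ * SemidirectProduct.inr a * κ⁻¹)
    (κ * SemidirectProduct.inr b * κ⁻¹)
  have hright : ∀ g, (Ψ g).right = g := by
    intro g
    have : SemidirectProduct.rightHom.comp Ψ = MonoidHom.id G := by
      apply h.hom_ext
      · intro g hg
        simp [show Ψ g = _ from h1 ⟨g, hg⟩]
      · simp [ha, κ]
      · simp [hb, κ]
    exact DFunLike.congr_fun this g
  refine ⟨fun y g => (Ψ g).left y, ?_, ?_, ?_⟩
  · intro y g g'
    simp [hright, hact]
  · intro y g hg
    simp [show Ψ g = _ from h1 ⟨g, hg⟩]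
  · intro y w
    have : Ψ.comp (FreeGroup.lift ![a, b]) = (MulAut.conj κ).toMonoidHom.comp
        (SemidirectProduct.inr.comp (FreeGroup.lift ![a, b])) := by
      ext i : 1
      fin_cases i
      · simp [ha]
      · simp [hb]
    have h2 : Ψ (FreeGroup.lift ![a, b] w) =
      κ * SemidirectProduct.inr (FreeGroup.lift ![a, b] w) * κ⁻¹ := DFunLike.congr_fun this w
    change (Ψ (FreeGroup.lift ![a, b] w)).left y = _
    rw [h2]
    simp [κ, hact]

/-- The value is the product of the inverse of each syllable's starting point with its end point.
The hypotheses say that consecutive points along the path in `Y` differ, so nothing cancels. -/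
theorem cocycle_pairProd_ne_one {Y : Type*} [MulAction G Y] {c : Y → G → FreeGroup Y}
    (hmul : ∀ y g g', c y (g * g') = c y g * c (g⁻¹ • y) g')
    (h₁ : ∀ y, ∀ g ∈ G₁, c y g = 1)
    (hF : ∀ y w, c y (FreeGroup.lift ![a, b] w) =
      (FreeGroup.of y)⁻¹ * FreeGroup.of ((FreeGroup.lift ![a, b] w)⁻¹ • y))
    {l : List (FreeGroup (Fin 2) × G₁)} (hl : l ≠ []) {y : Y}
    (hf : ∀ l₁ f x l₂, l = l₁ ++ (f, x) :: l₂ →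
      (FreeGroup.lift ![a, b] f)⁻¹ • (pairProd a b l₁)⁻¹ • y ≠ (pairProd a b l₁)⁻¹ • y)
    (hx : ∀ l₁ f (x : G₁) l₂, l = l₁ ++ (f, x) :: l₂ → l₂ ≠ [] →
      (x : G)⁻¹ • (FreeGroup.lift ![a, b] f)⁻¹ • (pairProd a b l₁)⁻¹ • y ≠
        (FreeGroup.lift ![a, b] f)⁻¹ • (pairProd a b l₁)⁻¹ • y) :
    c y (pairProd a b l) ≠ 1 := by
  classical
  -- The first letter is carried through the induction because it decides whether the preceding
  -- syllable cancels against the rest.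
  suffices H : ∃ L, c y (pairProd a b l) = FreeGroup.mk L ∧ FreeGroup.IsReduced L ∧
      L.head? = some (y, false) by
    obtain ⟨L, h1, h2, h3⟩ := H
    intro h4
    rw [h1] at h4
    have := congrArg FreeGroup.toWord h4
    rw [FreeGroup.toWord_mk, h2.reduce_eq, FreeGroup.toWord_one] at this
    simp [this] at h3
  induction l generalizing y with
  | nil => exact absurd rfl hl
  | cons p l ih =>
    obtain ⟨f, x⟩ := p
    have h1 := hf [] f x l rfl
    simp only [pairProd_nil, inv_one, one_smul] at h1
    have hc : ∀ g, c y (FreeGroup.lift ![a, b] f * (x : G) * g) =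
        FreeGroup.mk [(y, false), ((FreeGroup.lift ![a, b] f)⁻¹ • y, true)] *
          c ((x : G)⁻¹ • (FreeGroup.lift ![a, b] f)⁻¹ • y) g := by
      intro g
      rw [mul_assoc, hmul, hmul, h₁ _ _ x.2, one_mul, hF]
      rfl
    by_cases hl' : l = []
    · subst hl'
      refine ⟨[(y, false), ((FreeGroup.lift ![a, b] f)⁻¹ • y, true)], ?_, ?_, rfl⟩
      · have := hc 1
        rw [mul_one] at this
        rw [pairProd_cons, pairProd_nil, mul_one, this, h₁ _ _ (one_mem _), mul_one]
      · rw [FreeGroup.isReduced_cons_cons]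
        exact ⟨fun e => absurd e.symm h1, FreeGroup.IsReduced.singleton⟩
    · have h2 := hx [] f x l rfl hl'
      simp only [pairProd_nil, inv_one, one_smul] at h2
      obtain ⟨L, hL, hred, hhead⟩ := ih hl'
        (y := (x : G)⁻¹ • (FreeGroup.lift ![a, b] f)⁻¹ • y)
        (fun l₁ f' x' l₂ e => by
          have := hf ((f, x) :: l₁) f' x' l₂ (by rw [e]; rfl)
          simpa [mul_smul] using this)
        (fun l₁ f' x' l₂ e hl₂ => by
          have := hx ((f, x) :: l₁) f' x' l₂ (by rw [e]; rfl) hl₂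
          simpa [mul_smul] using this)
      refine ⟨(y, false) :: ((FreeGroup.lift ![a, b] f)⁻¹ • y, true) :: L, ?_, ?_, rfl⟩
      · rw [pairProd_cons, hc, hL, FreeGroup.mul_mk]
        rfl
      · obtain ⟨z, L', rfl⟩ : ∃ z L', L = z :: L' := by
          cases L with
          | nil => simp at hhead
          | cons z L' => exact ⟨z, L', rfl⟩
        simp only [List.head?_cons, Option.some.injEq] at hhead
        subst hhead
        rw [FreeGroup.isReduced_cons_cons, FreeGroup.isReduced_cons_cons]
        exact ⟨fun e => absurd e.symm h1, fun e => absurd e.symm h2, hred⟩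

/-- A free factor that contains `G₁` and has no further exponent sums is equal to `G₁`. -/
theorem eq_of_expSum (h : IsFreeSplitting G₁ a b) (hH : IsInternalFreeProduct H)
    (ho : G₁ ≤ H o) (hi : ∀ x ∈ H o, h.expSum x = 1) : H o = G₁ := by
  have hq : ∀ x ∈ H o, h.toFree x = 1 := fun x hx =>
    h.hom_eq_one_of_expSum hH ho hi (h.toFree.comp (H o).subtype)
      (fun y hy => h.toFree_of_mem hy) ⟨x, hx⟩
  obtain ⟨c, hmul, h₁, hF⟩ := h.exists_free_cocycle (G ⧸ H o)
  -- At the base coset, which `H o` fixes, the cocycle is a homomorphism to a free group that kills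
  -- `G₁`. A shortest word for an element of `H o` outside `G₁` would have non-trivial value.
  have hc : ∀ x ∈ H o, c (1 : G) x = 1 := by
    let χ : H o →* FreeGroup (G ⧸ H o) := MonoidHom.mk' (fun x => c (1 : G) x) (by
      intro x y
      rw [Subgroup.coe_mul, hmul]
      have : (x : G)⁻¹ • ((1 : G) : G ⧸ H o) = (1 : G) := by
        rw [MulAction.Quotient.smul_coe, QuotientGroup.eq]
        simp
      rw [this])
    exact fun x hx => h.hom_eq_one_of_expSum hH ho hi χ (fun y hy => h₁ _ _ hy) ⟨x, hx⟩
  by_contra hne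
  have hex : ∃ n, ∃ l : List (FreeGroup (Fin 2) × G₁), l.length = n ∧ pairProd a b l ∈ H o ∧
      pairProd a b l ∉ G₁ := by
    by_contra hno
    push Not at hno
    refine hne (le_antisymm (fun x hx => ?_) ho)
    obtain ⟨l, rfl⟩ := h.exists_pairProd_eq x
    exact hno _ l rfl hx
  classical
  obtain ⟨l, hlen, hlH, hlG⟩ := Nat.find_spec hex
  have hmin : ∀ l' : List (FreeGroup (Fin 2) × G₁), l'.length < l.length →
      pairProd a b l' ∈ H o → pairProd a b l' ∈ G₁ := by
    intro l' hl' hm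
    by_contra hn
    rw [hlen] at hl'
    exact Nat.find_min hex hl' ⟨l', rfl, hm, hn⟩
  refine cocycle_pairProd_ne_one (y := ((1 : G) : G ⧸ H o)) hmul h₁ hF (l := l) ?_ ?_ ?_ (hc _ hlH)
  · rintro rfl
    exact hlG (one_mem _)
  · rintro l₁ f x l₂ rfl he
    simp only [MulAction.Quotient.smul_coe, smul_eq_mul, mul_one] at he
    rw [QuotientGroup.eq] at he
    -- A stationary free syllable is conjugate into `H o`, which lies in the kernel of `toFree`. It
    -- is therefore trivial, and its `G₁`-letter can be merged with the preceding one.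
    have hf : f = 1 := by
      have := hq _ he
      simpa [h.lift_toFree_lift] using this
    subst hf
    rcases List.eq_nil_or_concat l₁ with rfl | ⟨l₁, ⟨f₀, x₀⟩, rfl⟩
    · have hp : pairProd a b l₂ = (x : G)⁻¹ * pairProd a b ([] ++ ((1, x) :: l₂)) := by simp
      have := hmin l₂ (by simp) (by rw [hp]; exact mul_mem (inv_mem (ho x.2)) hlH)
      exact hlG (by simpa using mul_mem x.2 this)
    · have hp : pairProd a b (l₁ ++ (f₀, x₀ * x) :: l₂) =
          pairProd a b (l₁.concat (f₀, x₀) ++ (1, x) :: l₂) := by simp [mul_assoc]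
      exact hlG (hp ▸ hmin (l₁ ++ (f₀, x₀ * x) :: l₂) (by simp) (hp ▸ hlH))
  · rintro l₁ f x l₂ rfl hl₂ he
    simp only [MulAction.Quotient.smul_coe, smul_eq_mul, mul_one] at he
    rw [QuotientGroup.eq] at he
    obtain ⟨⟨f₂, x₂⟩, l₃, rfl⟩ := List.exists_cons_of_ne_nil hl₂
    -- A trivial letter lets two free syllables merge. For a non-trivial one, malnormality of `H o`
    -- puts the prefix in `H o`, and the word splits into two shorter ones.
    by_cases hx1 : x = 1
    · subst hx1
      have hp : pairProd a b (l₁ ++ (f * f₂, x₂) :: l₃) =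
          pairProd a b (l₁ ++ (f, 1) :: (f₂, x₂) :: l₃) := by simp [mul_assoc]
      exact hlG (hp ▸ hmin (l₁ ++ (f * f₂, x₂) :: l₃) (by simp) (hp ▸ hlH))
    · have hp : pairProd a b (l₁ ++ [(f, 1)]) =
          pairProd a b l₁ * FreeGroup.lift ![a, b] f := by simp
      have hm : pairProd a b (l₁ ++ [(f, 1)]) ∈ H o := by
        rw [hp]
        refine hH.mem_of_conj_mem (x := (x : G)) (ho x.2) (by simpa using hx1) ?_
        simpa [mul_assoc] using he
      have hm1 := hmin _ (by simp) hm
      have hp2 : pairProd a b ((f₂, x₂) :: l₃) = (x : G)⁻¹ * (pairProd a b (l₁ ++ [(f, 1)]))⁻¹ *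
          pairProd a b (l₁ ++ (f, x) :: (f₂, x₂) :: l₃) := by
        simp [mul_assoc]
      have hm2 := hmin ((f₂, x₂) :: l₃) (by simp; omega) (by
        rw [hp2]
        exact mul_mem (mul_mem (inv_mem (ho x.2)) (inv_mem hm)) hlH)
      apply hlG
      have hp3 : pairProd a b (l₁ ++ (f, x) :: (f₂, x₂) :: l₃) =
          pairProd a b (l₁ ++ [(f, 1)]) * x * pairProd a b ((f₂, x₂) :: l₃) := by
        simp [mul_assoc]
      rw [hp3]
      exact mul_mem (mul_mem hm1 x.2) hm2

end IsFreeSplitting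

end FreeProd

/-! ### Derivations, and traces on the group ring. -/

namespace FreeProd

/-- A derivation of `G` with values in the group ring of `Γ`, on which `G` acts through `ρ`. -/
def IsDerivation {G Γ : Type*} [Group G] [Group Γ] (ρ : G →* Γ) (δ : G → MonoidAlgebra ℤ Γ) :
    Prop :=
  ∀ g g', δ (g * g') = δ g + MonoidAlgebra.of ℤ Γ (ρ g) * δ g'

namespace IsDerivation

open MonoidAlgebra

variable {G Γ : Type*} [Group G] [Group Γ] {ρ : G →* Γ} {δ δ' : G → MonoidAlgebra ℤ Γ}

theorem apply_one (hδ : IsDerivation ρ δ) : δ 1 = 0 := by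
  have := hδ 1 1
  rwa [mul_one, map_one, map_one, one_mul, left_eq_add] at this

theorem apply_inv (hδ : IsDerivation ρ δ) (g : G) : δ g⁻¹ = -(of ℤ Γ (ρ g⁻¹) * δ g) := by
  have := hδ g⁻¹ g
  rw [inv_mul_cancel, hδ.apply_one] at this
  exact eq_neg_of_add_eq_zero_left this.symm

theorem eq_of_closure (hδ : IsDerivation ρ δ) (hδ' : IsDerivation ρ δ') {s : Set G}
    (hs : Subgroup.closure s = ⊤) (h : ∀ x ∈ s, δ x = δ' x) (g : G) : δ g = δ' g := by
  have hg : g ∈ Subgroup.closure s := by rw [hs]; trivial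
  induction hg using Subgroup.closure_induction with
  | mem x hx => exact h x hx
  | one => rw [hδ.apply_one, hδ'.apply_one]
  | mul x y _ _ hx hy => rw [hδ, hδ', hx, hy]
  | inv x _ hx => rw [hδ.apply_inv, hδ'.apply_inv, hx]

theorem mul_add_mul (hδ : IsDerivation ρ δ) (hδ' : IsDerivation ρ δ') (x y : MonoidAlgebra ℤ Γ) :
    IsDerivation ρ (fun g => δ g * x + δ' g * y) := by
  intro g g'
  simp only [hδ g g', hδ' g g', mul_add, add_mul, mul_assoc]
  abel

theorem comp (hδ : IsDerivation ρ δ) {ψ : G →* G} (hψ : ∀ g, ρ (ψ g) = ρ g) :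
    IsDerivation ρ (fun g => δ (ψ g)) := by
  intro g g'
  change δ (ψ (g * g')) = _
  rw [map_mul, hδ, hψ]

theorem apply_conj (hδ : IsDerivation ρ δ) (γ : G) {x : G} (hx : ρ x = 1) :
    δ (γ * x * γ⁻¹) = of ℤ Γ (ρ γ) * δ x := by
  rw [hδ, hδ, hδ.apply_inv]
  rw [map_mul ρ, hx, mul_one, mul_neg, ← mul_assoc, ← map_mul, ← map_mul, mul_inv_cancel, map_one,
    map_one, one_mul]
  abel

end IsDerivation

/-- The action of a group on the additive group of its group ring by left multiplication. -/
noncomputable def mulLeftAut (Γ : Type*) [Group Γ] :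
    Γ →* MulAut (Multiplicative (MonoidAlgebra ℤ Γ)) :=
  (MulAutMultiplicative (MonoidAlgebra ℤ Γ)).symm.toMonoidHom.comp
    ((DistribMulAction.toAddAut (MonoidAlgebra ℤ Γ)ˣ (MonoidAlgebra ℤ Γ)).comp
      (MonoidHom.toHomUnits (MonoidAlgebra.of ℤ Γ)))

theorem mulLeftAut_apply {Γ : Type*} [Group Γ] (γ : Γ) (x : Multiplicative (MonoidAlgebra ℤ Γ)) :
    (mulLeftAut Γ γ x).toAdd = MonoidAlgebra.of ℤ Γ γ * x.toAdd := rfl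

theorem isDerivation_of_hom {G Γ : Type*} [Group G] [Group Γ] {ρ : G →* Γ}
    (Ψ : G →* Multiplicative (MonoidAlgebra ℤ Γ) ⋊[mulLeftAut Γ] Γ)
    (h : ∀ g, (Ψ g).right = ρ g) : IsDerivation ρ (fun g => (Ψ g).left.toAdd) := by
  intro g g'
  change (Ψ (g * g')).left.toAdd = _
  rw [map_mul, SemidirectProduct.mul_left, toAdd_mul, mulLeftAut_apply, h]

section Trace

variable {Γ : Type*} [Group Γ]

open MonoidAlgebra

/-- The coefficient of the identity. -/
noncomputable def coeffOne (Γ : Type*) [Group Γ] : MonoidAlgebra ℤ Γ →+ ℤ where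
  toFun x := x.coeff 1
  map_zero' := by simp
  map_add' x y := by simp

theorem coeffOne_of [DecidableEq Γ] (g : Γ) : coeffOne Γ (of ℤ Γ g) = if g = 1 then 1 else 0 := by
  change (of ℤ Γ g).coeff 1 = _
  simp [Finsupp.single_apply]

theorem coeffOne_mul_comm (x y : MonoidAlgebra ℤ Γ) :
    coeffOne Γ (x * y) = coeffOne Γ (y * x) := by
  classical
  induction x using MonoidAlgebra.induction_on with
  | of g =>
    induction y using MonoidAlgebra.induction_on with
    | of g' =>
      rw [← map_mul, ← map_mul, coeffOne_of, coeffOne_of]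
      congr 1
      rw [mul_eq_one_iff_eq_inv, mul_eq_one_iff_inv_eq, eq_comm]
      exact propext ⟨fun h => h.symm, fun h => h.symm⟩
    | add x y hx hy => rw [mul_add, add_mul, map_add, map_add, hx, hy]
    | smul r x hx => rw [mul_smul_comm, smul_mul_assoc, map_zsmul, map_zsmul, hx]
  | add x y hx hy => rw [mul_add, add_mul, map_add, map_add, hx, hy]
  | smul r x hx => rw [mul_smul_comm, smul_mul_assoc, map_zsmul, map_zsmul, hx]

/-- The augmentation. -/
noncomputable def augmentation (Γ : Type*) [Group Γ] : MonoidAlgebra ℤ Γ →+* ℤ :=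
  (MonoidAlgebra.lift ℤ ℤ Γ (1 : Γ →* ℤ)).toRingHom

theorem augmentation_of (g : Γ) : augmentation Γ (of ℤ Γ g) = 1 := by
  simp [augmentation]

/-- The sum in the group ring of a list of group elements. -/
noncomputable def listSum (l : List Γ) : MonoidAlgebra ℤ Γ := (l.map (of ℤ Γ)).sum

@[simp] theorem listSum_nil : listSum ([] : List Γ) = 0 := rfl

@[simp] theorem listSum_cons (g : Γ) (l : List Γ) :
    listSum (g :: l) = of ℤ Γ g + listSum l := by simp [listSum]

@[simp] theorem listSum_append (l l' : List Γ) :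
    listSum (l ++ l') = listSum l + listSum l' := by simp [listSum]

theorem listSum_map_mul (g : Γ) (l : List Γ) :
    listSum (l.map (g * ·)) = of ℤ Γ g * listSum l := by
  induction l with
  | nil => simp
  | cons x l ih => rw [List.map_cons, listSum_cons, listSum_cons, ih, mul_add, map_mul]

theorem augmentation_listSum (l : List Γ) : augmentation Γ (listSum l) = l.length := by
  induction l with
  | nil => simp
  | cons x l ih => rw [listSum_cons, map_add, ih, augmentation_of]; simp [add_comm]

theorem coeffOne_listSum [DecidableEq Γ] (l : List Γ) :
    coeffOne Γ (listSum l) = l.count 1 := by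
  induction l with
  | nil => simp
  | cons x l ih =>
    rw [listSum_cons, map_add, ih, coeffOne_of, List.count_cons]
    by_cases h : x = 1 <;> simp [h, add_comm]

/-- The augmentation gives `N = l.length`, the coefficient of `1` gives `N` or `0`. As `1` occurs in
`l`, the latter is positive, so every entry is counted. -/
theorem eq_one_of_mem_of_traces {l : List Γ} (h1 : 1 ∈ l) {N : ℤ} {γ : Γ}
    (ha : augmentation Γ (listSum l) = N * augmentation Γ (of ℤ Γ γ))
    (hc : coeffOne Γ (listSum l) = N * coeffOne Γ (of ℤ Γ γ)) {x : Γ} (hx : x ∈ l) : x = 1 := by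
  classical
  rw [augmentation_listSum, augmentation_of, mul_one] at ha
  rw [coeffOne_listSum, coeffOne_of] at hc
  have hpos : 0 < l.count 1 := List.count_pos_iff.2 h1
  have hcount : l.count 1 = l.length := by
    split_ifs at hc with hγ <;> omega
  exact (List.count_eq_length.1 hcount x hx).symm

/-- The group elements carried by the paths of length `n` with a given initial vector, in the
graph with one edge from `a` to `b`, labelled `y n` at time `n`, and trivially labelled edges from
`b` to `a` and from `b` to `b`; the components collect the paths by end point. -/
def pathLabels (y : ℕ → Γ) (s : List Γ × List Γ) : ℕ → List Γ × List Γ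
  | 0 => s
  | n + 1 => ((pathLabels y s n).2,
      (pathLabels y s n).2 ++ (pathLabels y s n).1.map (y n * ·))

theorem one_mem_pathLabels (y : ℕ → Γ) (n : ℕ) : 1 ∈ (pathLabels y ([], [1]) n).2 := by
  induction n with
  | zero => simp [pathLabels]
  | succ n ih => exact List.mem_append_left _ ih

/-- The path stays at `b` for `m` steps, moves to `a`, returns along the edge labelled `y (m + 1)`,
and stays at `b` afterwards. -/
theorem label_mem_pathLabels (y : ℕ → Γ) {m n : ℕ} (h : m + 2 ≤ n) :
    y (m + 1) ∈ (pathLabels y ([], [1]) n).2 := by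
  induction n, h using Nat.le_induction with
  | base =>
    refine List.mem_append_right _ (List.mem_map.2 ⟨1, one_mem_pathLabels y m, mul_one _⟩)
  | succ n _ ih => exact List.mem_append_left _ ih

end Trace

end FreeProd

/-! ### Fox Jacobians and complements of `G₁`. -/

namespace FreeProd

namespace IsFreeSplitting

open MonoidAlgebra

variable {G : Type*} [Group G] {G₁ : Subgroup G} {a b : G}

theorem exists_derivation (h : IsFreeSplitting G₁ a b) {Γ : Type*} [Group Γ] (ρ : G →* Γ)
    (x y : MonoidAlgebra ℤ Γ) : ∃ δ : G → MonoidAlgebra ℤ Γ, IsDerivation ρ δ ∧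
      (∀ g ∈ G₁, δ g = 0) ∧ δ a = x ∧ δ b = y := by
  obtain ⟨Ψ, h1, ha, hb⟩ := h.exists_extension
    (K := Multiplicative (MonoidAlgebra ℤ Γ) ⋊[mulLeftAut Γ] Γ)
    (SemidirectProduct.inr.comp (ρ.comp G₁.subtype)) ⟨Multiplicative.ofAdd x, ρ a⟩
    ⟨Multiplicative.ofAdd y, ρ b⟩
  refine ⟨_, isDerivation_of_hom Ψ (fun g => ?_), fun g hg => ?_, ?_, ?_⟩
  · have : SemidirectProduct.rightHom.comp Ψ = ρ := by
      apply h.hom_ext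
      · intro g hg
        simp [show Ψ g = _ from h1 ⟨g, hg⟩]
      · simp [ha]
      · simp [hb]
    exact DFunLike.congr_fun this g
  · simp [show Ψ g = _ from h1 ⟨g, hg⟩]
  · simp [ha]
  · simp [hb]

theorem derivation_eq (h : IsFreeSplitting G₁ a b) {Γ : Type*} [Group Γ] {ρ : G →* Γ}
    {δ δa δb : G → MonoidAlgebra ℤ Γ} (hδ : IsDerivation ρ δ) (h₁ : ∀ g ∈ G₁, δ g = 0)
    (hδa : IsDerivation ρ δa) (ha₁ : ∀ g ∈ G₁, δa g = 0) (haa : δa a = 1) (hab : δa b = 0)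
    (hδb : IsDerivation ρ δb) (hb₁ : ∀ g ∈ G₁, δb g = 0) (hba : δb a = 0) (hbb : δb b = 1)
    (g : G) : δ g = δa g * δ a + δb g * δ b := by
  refine hδ.eq_of_closure (hδa.mul_add_mul hδb _ _) h.closure_eq_top ?_ g
  rintro x (hx | rfl | rfl)
  · simp [h₁ x hx, ha₁ x hx, hb₁ x hx]
  · simp [haa, hba]
  · simp [hab, hbb]

variable {C : Subgroup G}

theorem closure_union_eq_top
    (hC : IsInternalFreeProduct (![G₁, C] : Fin 2 → Subgroup G)) :
    Subgroup.closure ((G₁ : Set G) ∪ C) = ⊤ := by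
  rw [eq_top_iff, ← hC.iSup_eq_top]
  refine iSup_le fun i => ?_
  fin_cases i
  · exact fun x hx => Subgroup.subset_closure (Or.inl hx)
  · exact fun x hx => Subgroup.subset_closure (Or.inr hx)

theorem exists_derivation_complement (h : IsFreeSplitting G₁ a b)
    (hC : IsInternalFreeProduct (![G₁, C] : Fin 2 → Subgroup G)) {Γ : Type*} [Group Γ]
    {ρ : G →* Γ} (hρ : ∀ x ∈ C, ρ x = 1) (e : ℤ × ℤ →+ MonoidAlgebra ℤ Γ) :
    ∃ δ : G → MonoidAlgebra ℤ Γ, IsDerivation ρ δ ∧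
      (∀ g ∈ G₁, δ g = 0) ∧ ∀ x ∈ C, δ x = e (h.expSum x).toAdd := by
  obtain ⟨Ψ, hΨ⟩ := hC.exists_extension
    (K := Multiplicative (MonoidAlgebra ℤ Γ) ⋊[mulLeftAut Γ] Γ)
    (Fin.cons (SemidirectProduct.inr.comp (ρ.comp G₁.subtype)) (Fin.cons
      (SemidirectProduct.inl.comp ((AddMonoidHom.toMultiplicative e).comp
        (h.expSum.comp C.subtype))) finZeroElim))
  have h0 : ∀ g ∈ G₁, Ψ g = SemidirectProduct.inr (ρ g) := fun g hg => hΨ 0 ⟨g, hg⟩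
  have h1 : ∀ g ∈ C, Ψ g = SemidirectProduct.inl (AddMonoidHom.toMultiplicative e (h.expSum g)) :=
    fun g hg => hΨ 1 ⟨g, hg⟩
  refine ⟨_, isDerivation_of_hom Ψ (fun g => ?_), fun g hg => ?_, fun g hg => ?_⟩
  · have : SemidirectProduct.rightHom.comp Ψ = ρ := by
      apply hC.hom_ext
      intro i
      fin_cases i
      · rintro ⟨x, hx⟩
        change (Ψ x).right = ρ x
        simp [h0 x hx]
      · rintro ⟨x, hx⟩
        change (Ψ x).right = ρ x
        simp [h1 x hx, hρ x hx]
    exact DFunLike.congr_fun this g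
  · simp [h0 g hg]
  · simp [h1 g hg]

/-- As `ρ` is trivial on `C`, a derivation restricts there to a homomorphism into an abelian group.
Extended trivially over `G₁`, it factors through `expSum`. -/
theorem derivation_complement_eq (h : IsFreeSplitting G₁ a b)
    (hC : IsInternalFreeProduct (![G₁, C] : Fin 2 → Subgroup G)) {Γ : Type*} [Group Γ]
    {ρ : G →* Γ} (hρ : ∀ x ∈ C, ρ x = 1) {δ : G → MonoidAlgebra ℤ Γ} (hδ : IsDerivation ρ δ)
    {u w : G} (hu : u ∈ C) (hw : w ∈ C) (hu' : h.expSum u = Multiplicative.ofAdd (1, 0))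
    (hw' : h.expSum w = Multiplicative.ofAdd (0, 1)) {x : G} (hx : x ∈ C) :
    δ x = ((h.expSum x).toAdd.1 : MonoidAlgebra ℤ Γ) * δ u +
      ((h.expSum x).toAdd.2 : MonoidAlgebra ℤ Γ) * δ w := by
  let χ : C →* Multiplicative (MonoidAlgebra ℤ Γ) :=
    MonoidHom.mk' (fun x => Multiplicative.ofAdd (δ x)) (by
      intro x y
      rw [← ofAdd_add, Subgroup.coe_mul, hδ, hρ x x.2, map_one, one_mul])
  obtain ⟨ψ, h1, -, h3⟩ := exists_extension_single hC (o := 0) (G₁ := G₁) le_rfl 1 χ (by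
    intro y hy
    have : y = 1 := Subtype.ext (hC.eq_one_of_mem_of_mem (i := 1) (j := 0) (by decide) y.2 hy)
    rw [this]
    exact map_one χ)
  have hψ : ∀ y ∈ C, ψ y = Multiplicative.ofAdd (δ y) := fun y hy => h1 ⟨y, hy⟩
  have hua : ψ a = Multiplicative.ofAdd (δ u) := by
    rw [← hψ u hu, h.hom_eq_expSum ψ h3 u, hu']
    simp
  have hwb : ψ b = Multiplicative.ofAdd (δ w) := by
    rw [← hψ w hw, h.hom_eq_expSum ψ h3 w, hw']
    simp
  have := hψ x hx
  rw [h.hom_eq_expSum ψ h3 x, hua, hwb, ← ofAdd_zsmul, ← ofAdd_zsmul, ← ofAdd_add] at this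
  rw [← Multiplicative.ofAdd.injective this, zsmul_eq_mul, zsmul_eq_mul]

variable {g₁ : G} {φ : MulAut G}

/-- The values on `φⁿ a` and `φⁿ b` of a derivation, as sums over the paths of length `n`. -/
theorem IsTwist.derivation_pow (hφ : IsTwist G₁ a b g₁ φ) (hg : g₁ ∈ G₁) {Γ : Type*}
    [Group Γ] {ρ : G →* Γ} {δ : G → MonoidAlgebra ℤ Γ} (hδ : IsDerivation ρ δ)
    (h₁ : ∀ g ∈ G₁, δ g = 0) {s : List Γ × List Γ} (ha : δ a = listSum s.1)
    (hb : δ b = listSum s.2) (n : ℕ) :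
    δ ((φ ^ n) a) = listSum (pathLabels (fun n => ρ ((φ ^ n) b)) s n).1 ∧
      δ ((φ ^ n) b) = listSum (pathLabels (fun n => ρ ((φ ^ n) b)) s n).2 := by
  induction n with
  | zero => exact ⟨ha, hb⟩
  | succ n ih =>
    rw [pow_succ, MulAut.mul_apply, MulAut.mul_apply, hφ.map_left, hφ.map_right, map_mul,
      map_mul, hφ.pow_map_mem n hg, hδ, hδ, h₁ g₁ hg, mul_zero, add_zero, ih.1, ih.2]
    refine ⟨rfl, ?_⟩
    change _ = listSum (_ ++ _)
    rw [listSum_append, listSum_map_mul]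

/-- A trace on the group ring of `Γ`, evaluated on the Jacobian of an automorphism `θ` that
preserves the complement `C` of `G₁` up to conjugation by `γ`, is an integral multiple, independent
of the trace, of its value on the image of `γ`. -/
theorem exists_trace_jacobian (h : IsFreeSplitting G₁ a b)
    (hC : IsInternalFreeProduct (![G₁, C] : Fin 2 → Subgroup G)) {Γ : Type*} [Group Γ]
    {ρ : G →* Γ} (hρ : ∀ x ∈ C, ρ x = 1) {θ : MulAut G} (hθ₁ : ∀ x ∈ G₁, θ x = x) {γ : G}
    (hθ : ∀ x ∈ C, ∃ y ∈ C, θ x = γ * y * γ⁻¹) {δa δb : G → MonoidAlgebra ℤ Γ}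
    (hδa : IsDerivation ρ δa) (ha₁ : ∀ g ∈ G₁, δa g = 0) (haa : δa a = 1) (hab : δa b = 0)
    (hδb : IsDerivation ρ δb) (hb₁ : ∀ g ∈ G₁, δb g = 0) (hba : δb a = 0) (hbb : δb b = 1) :
    ∃ N : ℤ, ∀ t : MonoidAlgebra ℤ Γ →+ ℤ, (∀ x y, t (x * y) = t (y * x)) →
      t (δa (θ a) + δb (θ b)) = N * t (of ℤ Γ (ρ γ)) := by
  -- `G₁` and `C` generate `G` and `toFree` kills `G₁`, so `C` alone surjects. This supplies `u`,
  -- `w` in `C` with the exponent sums of `a`, `b`.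
  have hsurj : ∀ z : FreeGroup (Fin 2), ∃ x ∈ C, h.toFree x = z := by
    have : C.map h.toFree = ⊤ := by
      have h1 := congrArg (Subgroup.map h.toFree) (closure_union_eq_top hC)
      rw [MonoidHom.map_closure, Set.image_union, Subgroup.map_top_of_surjective h.toFree
        (fun z => ⟨_, h.lift_toFree_lift z⟩), Subgroup.closure_union] at h1
      rw [eq_top_iff, ← h1, sup_le_iff, Subgroup.closure_le, Subgroup.closure_le]
      refine ⟨?_, fun _ hx => hx⟩
      rintro _ ⟨x, hx, rfl⟩
      rw [h.toFree_of_mem hx]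
      exact one_mem _
    intro z
    have hz : z ∈ C.map h.toFree := by rw [this]; trivial
    exact hz
  obtain ⟨u, hu, hu'⟩ := hsurj (h.toFree a)
  obtain ⟨w, hw, hw'⟩ := hsurj (h.toFree b)
  have hu2 : h.expSum u = Multiplicative.ofAdd (1, 0) := by
    rw [h.expSum_eq_of_toFree_eq hu', h.expSum_left]
  have hw2 : h.expSum w = Multiplicative.ofAdd (0, 1) := by
    rw [h.expSum_eq_of_toFree_eq hw', h.expSum_right]
  obtain ⟨δu, hδu, hu₁, hue⟩ := h.exists_derivation_complement hC hρ
    ((Int.castAddHom (MonoidAlgebra ℤ Γ)).comp (AddMonoidHom.fst ℤ ℤ))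
  obtain ⟨δw, hδw, hw₁, hwe⟩ := h.exists_derivation_complement hC hρ
    ((Int.castAddHom (MonoidAlgebra ℤ Γ)).comp (AddMonoidHom.snd ℤ ℤ))
  have hbasis : ∀ δ : G → MonoidAlgebra ℤ Γ, IsDerivation ρ δ → (∀ g ∈ G₁, δ g = 0) →
      ∀ g, δ g = δu g * δ u + δw g * δ w := by
    intro δ hδ hδ₁ g
    refine hδ.eq_of_closure (hδu.mul_add_mul hδw _ _) (closure_union_eq_top hC) ?_ g
    rintro x (hx | hx)
    · simp [hδ₁ x hx, hu₁ x hx, hw₁ x hx]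
    · rw [h.derivation_complement_eq hC hρ hδ hu hw hu2 hw2 hx, hue x hx, hwe x hx]
      rfl
  have hρθ : ∀ g, ρ (θ.toMonoidHom g) = ρ g := by
    intro g
    have : ρ.comp θ.toMonoidHom = ρ := by
      apply hC.hom_ext
      intro i
      fin_cases i
      · rintro ⟨x, hx⟩
        exact congrArg ρ (hθ₁ x hx)
      · rintro ⟨x, hx⟩
        obtain ⟨y, hy, hxy⟩ := hθ x hx
        change ρ (θ x) = ρ x
        rw [hxy, hρ x hx, map_mul, map_mul, hρ y hy, mul_one, ← map_mul, mul_inv_cancel, map_one]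
    exact DFunLike.congr_fun this g
  obtain ⟨u', hu'C, hu'θ⟩ := hθ u hu
  obtain ⟨w', hw'C, hw'θ⟩ := hθ w hw
  have huθ : ∀ δ : G → MonoidAlgebra ℤ Γ, IsDerivation ρ δ → δ (θ u) = of ℤ Γ (ρ γ) *
      (((h.expSum u').toAdd.1 : MonoidAlgebra ℤ Γ) * δ u +
        ((h.expSum u').toAdd.2 : MonoidAlgebra ℤ Γ) * δ w) := by
    intro δ hδ
    rw [hu'θ, hδ.apply_conj γ (hρ u' hu'C),
      h.derivation_complement_eq hC hρ hδ hu hw hu2 hw2 hu'C]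
  have hwθ : ∀ δ : G → MonoidAlgebra ℤ Γ, IsDerivation ρ δ → δ (θ w) = of ℤ Γ (ρ γ) *
      (((h.expSum w').toAdd.1 : MonoidAlgebra ℤ Γ) * δ u +
        ((h.expSum w').toAdd.2 : MonoidAlgebra ℤ Γ) * δ w) := by
    intro δ hδ
    rw [hw'θ, hδ.apply_conj γ (hρ w' hw'C),
      h.derivation_complement_eq hC hρ hδ hu hw hu2 hw2 hw'C]
  have hexp : ∀ δ : G → MonoidAlgebra ℤ Γ, IsDerivation ρ δ → (∀ g ∈ G₁, δ g = 0) →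
      ∀ g, δ (θ g) = δu g * δ (θ u) + δw g * δ (θ w) := by
    intro δ hδ hδ₁ g
    exact hbasis (fun g => δ (θ.toMonoidHom g)) (hδ.comp hρθ)
      (fun x hx => by
        change δ (θ x) = 0
        rw [hθ₁ x hx, hδ₁ x hx]) g
  have hcross : ∀ δ : G → MonoidAlgebra ℤ Γ, IsDerivation ρ δ → (∀ g ∈ G₁, δ g = 0) →
      ∀ g, δ g = δa g * δ a + δb g * δ b := fun δ hδ hδ₁ g =>
    h.derivation_eq hδ hδ₁ hδa ha₁ haa hab hδb hb₁ hba hbb g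
  -- The trace of the integral matrix by which `θ`, corrected by `γ`, acts on the exponent sums of
  -- `u` and `w`.
  refine ⟨(h.expSum u').toAdd.1 + (h.expSum w').toAdd.2, fun t ht => ?_⟩
  have hcast : ∀ (n : ℤ) (x y : MonoidAlgebra ℤ Γ),
      t (x * (of ℤ Γ (ρ γ) * ((n : MonoidAlgebra ℤ Γ) * y))) = n * t (of ℤ Γ (ρ γ) * (y * x)) := by
    intro n x y
    rw [ht x, ← zsmul_eq_mul, mul_smul_comm, smul_mul_assoc, map_zsmul, smul_eq_mul, mul_assoc]
  -- The two change-of-coordinates matrices multiply to the identity in this order. With cyclicity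
  -- of `t`, this makes the trace independent of coordinates.
  have e1 : δa u * δu a + δb u * δu b = 1 := by
    rw [← hcross δu hδu hu₁ u, hue u hu, hu2]; simp
  have e2 : δa w * δu a + δb w * δu b = 0 := by
    rw [← hcross δu hδu hu₁ w, hue w hw, hw2]; simp
  have e3 : δa u * δw a + δb u * δw b = 0 := by
    rw [← hcross δw hδw hw₁ u, hwe u hu, hu2]; simp
  have e4 : δa w * δw a + δb w * δw b = 1 := by
    rw [← hcross δw hδw hw₁ w, hwe w hw, hw2]; simp
  have f : ∀ x y x' y' : MonoidAlgebra ℤ Γ, t (of ℤ Γ (ρ γ) * (x * y)) +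
      t (of ℤ Γ (ρ γ) * (x' * y')) = t (of ℤ Γ (ρ γ) * (x * y + x' * y')) := by
    intro x y x' y'
    rw [mul_add, map_add]
  have f1 := f (δa u) (δu a) (δb u) (δu b)
  have f2 := f (δa w) (δu a) (δb w) (δu b)
  have f3 := f (δa u) (δw a) (δb u) (δw b)
  have f4 := f (δa w) (δw a) (δb w) (δw b)
  rw [e1, mul_one] at f1
  rw [e2, mul_zero, map_zero] at f2
  rw [e3, mul_zero, map_zero] at f3
  rw [e4, mul_one] at f4
  rw [hexp δa hδa ha₁ a, hexp δb hδb hb₁ b, huθ δa hδa, huθ δb hδb, hwθ δa hδa, hwθ δb hδb]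
  simp only [mul_add, map_add, hcast]
  linear_combination (h.expSum u').toAdd.1 * f1 + (h.expSum u').toAdd.2 * f2 +
    (h.expSum w').toAdd.1 * f3 + (h.expSum w').toAdd.2 * f4

/-- No power of the twist preserves a complement of `G₁` up to conjugation. -/
theorem IsTwist.eq_one_of_complement (hφ : IsTwist G₁ a b g₁ φ) (h : IsFreeSplitting G₁ a b)
    (hg : g₁ ∈ G₁) (hC : IsInternalFreeProduct (![G₁, C] : Fin 2 → Subgroup G)) {n : ℕ}
    (hn : 5 ≤ n) {γ : G} (hθ : ∀ x ∈ C, ∃ y ∈ C, (φ ^ n) x = γ * y * γ⁻¹) : g₁ = 1 := by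
  obtain ⟨ρ, hρ₁, hρ'⟩ := hC.exists_extension_single 0 (MonoidHom.id G₁)
  have hρ : ∀ x ∈ C, ρ x = 1 := hρ' 1 (by decide)
  obtain ⟨δa, hδa, ha₁, haa, hab⟩ := h.exists_derivation ρ 1 0
  obtain ⟨δb, hδb, hb₁, hba, hbb⟩ := h.exists_derivation ρ 0 1
  obtain ⟨N, hN⟩ := h.exists_trace_jacobian hC hρ (fun x hx => hφ.pow_map_mem n hx) hθ
    hδa ha₁ haa hab hδb hb₁ hba hbb
  have ja := (hφ.derivation_pow hg hδa ha₁ (s := ([1], [])) (by simp [haa, MonoidAlgebra.one_def])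
    (by simp [hab]) n).1
  have jb := (hφ.derivation_pow hg hδb hb₁ (s := ([], [1])) (by simp [hba])
    (by simp [hbb, MonoidAlgebra.one_def]) n).2
  set y : ℕ → G₁ := fun n => ρ ((φ ^ n) b) with hy
  rw [ja, jb, ← listSum_append] at hN
  set L := (pathLabels y ([1], []) n).1 ++ (pathLabels y ([], [1]) n).2 with hL
  have t1 := hN (augmentation G₁).toAddMonoidHom (fun x y => by
    change augmentation G₁ _ = augmentation G₁ _
    rw [map_mul, map_mul, mul_comm])
  have t2 := hN (coeffOne G₁) coeffOne_mul_comm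
  have h1L : 1 ∈ L := List.mem_append_right _ (one_mem_pathLabels y n)
  have hall : ∀ m, m + 2 ≤ n → y (m + 1) = 1 := fun m hm =>
    eq_one_of_mem_of_traces h1L t1 t2 (List.mem_append_right _ (label_mem_pathLabels y hm))
  have hstep : ∀ m, y (m + 1) = y m * ρ ((φ ^ m) a) := fun m => by
    simp only [hy]
    rw [pow_succ, MulAut.mul_apply, hφ.map_right, map_mul, map_mul]
  have ha1 : ∀ m, m + 3 ≤ n → ρ ((φ ^ (m + 1)) a) = 1 := fun m hm => by
    have := hstep (m + 1)
    rw [hall (m + 1) (by omega), hall m (by omega), one_mul] at this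
    exact this.symm
  -- Here `φ² a = φ b * g₁`, and `ρ` is already known to kill `φ² a` and `φ b`.
  have hlast := ha1 1 (by omega)
  rw [pow_succ, MulAut.mul_apply, hφ.map_left, map_mul, map_mul, hφ.pow_map_mem _ hg] at hlast
  change y (0 + 1) * _ = 1 at hlast
  rw [hall 0 (by omega), one_mul] at hlast
  have := hρ₁ ⟨g₁, hg⟩
  rw [hlast] at this
  exact (congrArg Subtype.val this).symm

end IsFreeSplitting

end FreeProd

/-! ### Invariant free factor systems and the IWIP property. -/

namespace FreeProd

section ConjClass

variable {G : Type*} [Group G]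

theorem mem_conjClass_self (H : Subgroup G) : H ∈ conjClass H := ⟨1, by simp⟩

theorem conjClass_conj (g : G) (H : Subgroup G) : conjClass (MulAut.conj g • H) = conjClass H := by
  ext K
  constructor
  · rintro ⟨x, rfl⟩
    exact ⟨x * g, by simp [mul_smul]⟩
  · rintro ⟨x, rfl⟩
    exact ⟨x * g⁻¹, by simp [mul_smul]⟩

theorem smul_conjClass (θ : MulAut G) (H : Subgroup G) :
    θ • conjClass H = conjClass (θ • H) := by
  have hc : ∀ x : G, θ • MulAut.conj x • H = MulAut.conj (θ x) • θ • H := by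
    intro x
    rw [← mul_smul, ← mul_smul]
    congr 1
    ext y
    simp
  ext K
  constructor
  · rintro ⟨_, ⟨x, rfl⟩, rfl⟩
    exact ⟨θ x, (hc x).symm⟩
  · rintro ⟨x, rfl⟩
    refine ⟨_, ⟨θ.symm x, rfl⟩, ?_⟩
    change θ • MulAut.conj (θ.symm x) • H = _
    rw [hc, MulEquiv.apply_symm_apply]

theorem conj_smul_conjClass (g : G) (H : Subgroup G) :
    MulAut.conj g • conjClass H = conjClass H := by
  rw [smul_conjClass, conjClass_conj]

theorem inn_le_autRel_range {ι : Type*} (H : ι → Subgroup G) :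
    Inn G ≤ AutRel (Set.range fun i => conjClass (H i)) := by
  rintro _ ⟨g, rfl⟩
  change MulAut.conj g • (Set.range fun i => conjClass (H i)) = Set.range fun i => conjClass (H i)
  rw [← Set.image_smul, ← Set.range_comp]
  congr 1
  ext1 i
  exact conj_smul_conjClass g (H i)

theorem outClass_mem_outRel_iff {A : Set (Set (Subgroup G))} (hA : Inn G ≤ AutRel A)
    {φ : MulAut G} : outClass φ ∈ OutRel A ↔ φ ∈ AutRel A := by
  refine ⟨?_, fun h => ⟨φ, h, rfl⟩⟩
  rintro ⟨ψ, hψ, he⟩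
  have := hA (QuotientGroup.eq.1 he)
  simpa using mul_mem hψ this

theorem IsInternalFreeProduct.pair {ι : Type*} {H : ι → Subgroup G}
    (hH : IsInternalFreeProduct H) {i j : ι} (hij : i ≠ j)
    (hbot : ∀ k, k ≠ i → k ≠ j → H k = ⊥) :
    IsInternalFreeProduct (![H i, H j] : Fin 2 → Subgroup G) := by
  classical
  apply isInternalFreeProduct_of_exists
  · rw [eq_top_iff, ← hH.iSup_eq_top]
    refine iSup_le fun k => ?_
    by_cases hi : k = i
    · subst hi
      exact le_iSup (![H k, H j] : Fin 2 → Subgroup G) 0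
    · by_cases hj : k = j
      · subst hj
        exact le_iSup (![H i, H k] : Fin 2 → Subgroup G) 1
      · rw [hbot k hi hj]
        exact bot_le
  · let f₀ : H i →* Monoid.CoprodI (fun k => (![H i, H j] : Fin 2 → Subgroup G) k) :=
      factorOf (![H i, H j] : Fin 2 → Subgroup G) 0
    let f₁ : H j →* Monoid.CoprodI (fun k => (![H i, H j] : Fin 2 → Subgroup G) k) :=
      factorOf (![H i, H j] : Fin 2 → Subgroup G) 1
    obtain ⟨ψ, hψ⟩ := hH.exists_extension
      (K := Monoid.CoprodI (fun k => (![H i, H j] : Fin 2 → Subgroup G) k))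
      (fun k => if h : k = i then h ▸ f₀ else if h : k = j then h ▸ f₁ else 1)
    refine ⟨ψ, fun k => ?_⟩
    fin_cases k
    · intro x
      have := hψ i x
      rw [dif_pos rfl] at this
      exact this
    · intro x
      have := hψ j x
      rw [dif_neg hij.symm, dif_pos rfl] at this
      exact this

end ConjClass

namespace IsFreeSplitting

variable {G : Type*} [Group G] {G₁ : Subgroup G} {a b g₁ : G} {φ : MulAut G}

theorem isFreeFactorSystem (h : IsFreeSplitting G₁ a b) (hG₁ : G₁ ≠ ⊥) :
    IsFreeFactorSystem {conjClass G₁} := by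
  have hinj : Function.Injective (FreeGroup.lift ![a, b] : FreeGroup (Fin 2) →* G) :=
    Function.LeftInverse.injective h.lift_toFree_lift
  let F := (FreeGroup.lift ![a, b] : FreeGroup (Fin 2) →* G).range
  let s := (FreeGroup.lift ![a, b] : FreeGroup (Fin 2) →* G).rangeRestrict
  let fam : Option (Fin 1) → Subgroup G := fun i => i.elim F (fun _ => G₁)
  refine ⟨1, fun _ => G₁, F, 2, fun _ => hG₁, ⟨(MonoidHom.ofInjective hinj).symm⟩, ?_, ?_⟩
  · change IsInternalFreeProduct fam
    apply isInternalFreeProduct_of_exists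
    · apply h.eq_top_of_le
      · exact le_iSup fam (some 0)
      · exact le_iSup fam none ⟨FreeGroup.of 0, by simp⟩
      · exact le_iSup fam none ⟨FreeGroup.of 1, by simp⟩
    · let f₀ : G₁ →* Monoid.CoprodI (fun i => fam i) := factorOf fam (some 0)
      let f₁ : F →* Monoid.CoprodI (fun i => fam i) := factorOf fam none
      obtain ⟨ψ, h0, ha, hb⟩ := h.exists_extension f₀ (f₁ (s (FreeGroup.of 0)))
        (f₁ (s (FreeGroup.of 1)))
      refine ⟨ψ, fun i => ?_⟩
      rcases i with _ | i
      · rintro ⟨_, w, rfl⟩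
        have : ψ.comp (FreeGroup.lift ![a, b]) = f₁.comp s := by
          ext i
          fin_cases i
          · simp [ha]
          · simp [hb]
        exact DFunLike.congr_fun this w
      · obtain rfl : i = 0 := Subsingleton.elim _ _
        exact h0
  · simp

theorem isProper (h : IsFreeSplitting G₁ a b) : IsProper {conjClass G₁} := by
  intro he
  rw [Set.singleton_eq_singleton_iff] at he
  obtain ⟨g, hg⟩ : G₁ ∈ conjClass (⊤ : Subgroup G) := he ▸ mem_conjClass_self G₁
  have htop : G₁ = ⊤ := by
    rw [← hg]
    exact Subgroup.Normal.conj_smul_eq_self g ⊤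
  have h1 := h.toFree_of_mem (g := a) (by rw [htop]; trivial)
  rw [h.toFree_left] at h1
  exact FreeGroup.of_ne_one _ h1

theorem IsTwist.mem_autRel (hφ : IsTwist G₁ a b g₁ φ) : φ ∈ AutRel {conjClass G₁} := by
  have h1 : φ • G₁ = G₁ := by
    ext x
    constructor
    · rintro ⟨y, hy, rfl⟩
      change φ y ∈ G₁
      rwa [hφ.map_mem y hy]
    · intro hx
      exact ⟨x, hx, hφ.map_mem x hx⟩
  change φ • ({conjClass G₁} : Set (Set (Subgroup G))) = _
  rw [Set.smul_set_singleton, smul_conjClass, h1]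

/-- The powers of `θ` move one class among finitely many, so some positive power fixes it. A further
fifth power makes the exponent at least `5`, large enough for the trace argument. -/
theorem exists_pow_conj {p : ℕ} {H : Fin p → Subgroup G} {θ : MulAut G}
    (hθ : θ ∈ AutRel (Set.range fun i => conjClass (H i))) (i : Fin p) :
    ∃ n, 5 ≤ n ∧ ∃ γ : G, ∀ x ∈ H i, ∃ y ∈ H i, (θ ^ n) x = γ * y * γ⁻¹ := by
  have hmem : ∀ n : ℕ, ∃ j, conjClass (H j) = θ ^ n • conjClass (H i) := by
    intro n
    have h1 : θ ^ n ∈ AutRel (Set.range fun i => conjClass (H i)) := pow_mem hθ n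
    have h2 : θ ^ n • (Set.range fun i => conjClass (H i)) = Set.range fun i => conjClass (H i) :=
      h1
    have h3 : θ ^ n • conjClass (H i) ∈ θ ^ n • (Set.range fun i => conjClass (H i)) :=
      Set.smul_mem_smul_set ⟨i, rfl⟩
    rwa [h2] at h3
  choose σ hσ using hmem
  obtain ⟨m, m', hlt, he⟩ : ∃ m m', m < m' ∧ σ m = σ m' := by
    obtain ⟨m, m', hne, he⟩ := Finite.exists_ne_map_eq_of_infinite σ
    rcases lt_or_gt_of_ne hne with h | h
    · exact ⟨m, m', h, he⟩
    · exact ⟨m', m, h, he.symm⟩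
  have hd : θ ^ (m' - m) • conjClass (H i) = conjClass (H i) := by
    have h1 : θ ^ m • θ ^ (m' - m) • conjClass (H i) = θ ^ m • conjClass (H i) := by
      rw [← mul_smul, ← pow_add, Nat.add_sub_cancel' hlt.le, ← hσ, ← hσ, he]
    exact smul_left_cancel _ h1
  refine ⟨(m' - m) * 5, by omega, ?_⟩
  have h5 : θ ^ ((m' - m) * 5) • conjClass (H i) = conjClass (H i) := by
    rw [pow_mul]
    generalize θ ^ (m' - m) = ψ at hd
    have : ψ ∈ MulAction.stabilizer (MulAut G) (conjClass (H i)) := hd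
    exact pow_mem this 5
  rw [smul_conjClass] at h5
  obtain ⟨γ, hγ⟩ : θ ^ ((m' - m) * 5) • H i ∈ conjClass (H i) := h5 ▸ mem_conjClass_self _
  refine ⟨γ, fun x hx => ?_⟩
  have h6 : (θ ^ ((m' - m) * 5)) x ∈ θ ^ ((m' - m) * 5) • H i :=
    Subgroup.smul_mem_pointwise_smul x _ (H i) hx
  rw [← hγ] at h6
  obtain ⟨y, hy, hyx⟩ := h6
  exact ⟨y, hy, hyx.symm⟩

/-- The exponent sums of `x` and of its image under the power of `φ` are linearly independent and
both come from `H i`. A non-zero multiple of any vector of `ℤ²` therefore comes from `H i`, and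
images of distinct factors meet trivially. -/
theorem IsTwist.expSum_eq_one_of_ne (hφ : IsTwist G₁ a b g₁ φ) (h : IsFreeSplitting G₁ a b)
    (hg : g₁ ∈ G₁) {ι : Type*} {H : ι → Subgroup G} (hH : IsInternalFreeProduct H) {o : ι}
    (ho : G₁ ≤ H o) {i j : ι} (hij : i ≠ j) {n : ℕ} {γ : G}
    (hγ : ∀ x ∈ H i, ∃ y ∈ H i, (φ ^ (n + 1)) x = γ * y * γ⁻¹) {x : G} (hx : x ∈ H i)
    (hx1 : h.expSum x ≠ 1) {z : G} (hz : z ∈ H j) : h.expSum z = 1 := by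
  obtain ⟨y, hy, hxy⟩ := hγ x hx
  obtain ⟨s, t, hst⟩ : ∃ s t, h.expSum x = Multiplicative.ofAdd (s, t) := ⟨_, _, rfl⟩
  obtain ⟨p, q, hpq⟩ : ∃ p q, h.expSum z = Multiplicative.ofAdd (p, q) := ⟨_, _, rfl⟩
  have hy2 := hφ.expSum_pow_map h hg n x hst
  rw [hxy, map_mul, map_mul, map_inv, mul_comm, inv_mul_cancel_left] at hy2
  have hst0 : (s, t) ≠ 0 := by
    intro h0
    apply hx1
    rw [hst, h0, ofAdd_zero]
  have hdet := mul_ne_zero (Int.natCast_ne_zero.2 (Nat.fib_pos.2 n.succ_pos).ne')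
    (sq_add_mul_sub_sq_ne_zero hst0)
  set s' : ℤ := Nat.fib n * s + Nat.fib (n + 1) * t with hs'
  set t' : ℤ := Nat.fib (n + 1) * s + Nat.fib (n + 2) * t with ht'
  set d : ℤ := (Nat.fib n.succ : ℤ) * (s ^ 2 + s * t - t ^ 2) with hd
  have hd' : d = s * t' - t * s' := by
    rw [hd, hs', ht', Nat.fib_add_two]
    push_cast
    ring
  -- Cramer's rule, with `d` the determinant of `(s, t)` and `(s', t')`.
  have key : h.expSum (z ^ d) = h.expSum (x ^ (p * t' - q * s') * y ^ (s * q - t * p)) := by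
    rw [map_mul, map_zpow, map_zpow, map_zpow, hst, hpq, hy2, ← ofAdd_zsmul, ← ofAdd_zsmul,
      ← ofAdd_zsmul, ← ofAdd_add, hd']
    congr 1
    ext
    · simp
      ring
    · simp
      ring
  have h1 := h.expSum_eq_one_of_eq hH ho hij.symm (zpow_mem hz d)
    (mul_mem (zpow_mem hx _) (zpow_mem hy _)) key
  rw [map_zpow, hpq, ← ofAdd_zsmul, ofAdd_eq_one, smul_eq_zero] at h1
  rw [hpq, h1.resolve_left hdet, ofAdd_zero]

theorem IsTwist.range_conjClass_eq_of_le (hφ : IsTwist G₁ a b g₁ φ) (h : IsFreeSplitting G₁ a b)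
    (hg : g₁ ∈ G₁) (hg1 : g₁ ≠ 1) {p : ℕ} {H : Fin p → Subgroup G} {F : Subgroup G}
    (hne : ∀ i, H i ≠ ⊥) (hH : IsInternalFreeProduct (fun i : Option (Fin p) => i.elim F H))
    (hproper : IsProper (Set.range fun i => conjClass (H i))) {k : ℕ} (hk : 1 ≤ k)
    (hinv : φ ^ k ∈ AutRel (Set.range fun i => conjClass (H i))) {o : Fin p} (ho : G₁ ≤ H o) :
    (Set.range fun i => conjClass (H i)) = {conjClass G₁} := by
  set fam : Option (Fin p) → Subgroup G := fun i => i.elim F H with hfam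
  have ho' : G₁ ≤ fam (some o) := ho
  have hpow : ∀ i, ∃ n, 4 ≤ n ∧ ∃ γ : G, ∀ x ∈ H i, ∃ y ∈ H i,
      (φ ^ (n + 1)) x = γ * y * γ⁻¹ := by
    intro i
    obtain ⟨n, hn, γ, hγ⟩ := exists_pow_conj hinv i
    have : 5 ≤ k * n := hn.trans (Nat.le_mul_of_pos_left n hk)
    refine ⟨k * n - 1, by omega, γ, ?_⟩
    rwa [Nat.sub_add_cancel (by omega), pow_mul]
  have hothers : ∀ i x, x ∈ H i → h.expSum x ≠ 1 → ∀ j, j ≠ some i → j ≠ some o →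
      fam j = ⊥ := by
    intro i x hx hx1 j hji hjo
    obtain ⟨n, -, γ, hγ⟩ := hpow i
    exact h.eq_bot_of_expSum hH ho' hjo fun z hz =>
      hφ.expSum_eq_one_of_ne h hg hH ho' (i := some i) hji.symm hγ hx hx1 hz
  have hsingle : (∀ i, i = o) → ∀ K : Subgroup G, H o = K →
      (Set.range fun i => conjClass (H i)) = {conjClass K} := by
    rintro hall K rfl
    ext c
    constructor
    · rintro ⟨i, rfl⟩
      rw [hall i]
      rfl
    · rintro rfl
      exact ⟨o, rfl⟩
  -- If `H o` has non-zero exponent sums it absorbs all of `G`. Otherwise it is `G₁`, and any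
  -- further member would be a complement preserved up to conjugation.
  by_cases hX : ∃ x ∈ H o, h.expSum x ≠ 1
  · obtain ⟨x, hx, hx1⟩ := hX
    have hbot : ∀ j, j ≠ some o → fam j = ⊥ := fun j hj => hothers o x hx hx1 j hj hj
    have hall : ∀ i, i = o := fun i => by
      by_contra hi
      exact hne i (hbot (some i) (by simpa using hi))
    have htop : H o = ⊤ := by
      rw [eq_top_iff, ← hH.iSup_eq_top]
      refine iSup_le fun j => ?_
      by_cases hj : j = some o
      · rw [hj]
        exact le_rfl
      · rw [hbot j hj]
        exact bot_le
    exact absurd (hsingle hall ⊤ htop) hproper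
  · push Not at hX
    have hoG : H o = G₁ := h.eq_of_expSum (H := fam) hH ho' hX
    by_cases hall : ∀ i, i = o
    · exact hsingle hall G₁ hoG
    · push Not at hall
      obtain ⟨i, hi⟩ := hall
      exfalso
      obtain ⟨x, hx, hx1⟩ : ∃ x ∈ H i, h.expSum x ≠ 1 := by
        by_contra hno
        push Not at hno
        exact hne i (h.eq_bot_of_expSum hH ho' (i := some i) (by simpa using hi) hno)
      have hpair := hH.pair (i := some o) (j := some i) (by simpa using Ne.symm hi)
        (fun j hj hj' => hothers i x hx hx1 j hj' hj)
      have hpair' : IsInternalFreeProduct (![G₁, H i] : Fin 2 → Subgroup G) := by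
        rw [← hoG]
        exact hpair
      obtain ⟨n, hn, γ, hγ⟩ := hpow i
      exact hg1 (hφ.eq_one_of_complement h hg hpair' (n := n + 1) (by omega) hγ)

theorem IsTwist.eq_of_refines (hφ : IsTwist G₁ a b g₁ φ) (h : IsFreeSplitting G₁ a b)
    (hg : g₁ ∈ G₁) (hg1 : g₁ ≠ 1) {k : ℕ} (hk : 1 ≤ k) {B : Set (Set (Subgroup G))}
    (hB : IsFreeFactorSystem B) (hproper : IsProper B) (hinv : outClass φ ^ k ∈ OutRel B)
    (href : Refines {conjClass G₁} B) : B = {conjClass G₁} := by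
  obtain ⟨p, H, F, m, hne, -, hH, rfl⟩ := hB
  obtain ⟨_, ⟨o, rfl⟩, _, ⟨c, rfl⟩, _, ⟨d, rfl⟩, hle⟩ := href _ rfl
  -- Refinement only compares conjugates. Conjugating the whole family by one element keeps both the
  -- free product and the classes, and puts `G₁` inside a member.
  have hle' : G₁ ≤ MulAut.conj (c⁻¹ * d) • H o := by
    rw [map_mul, mul_smul, map_inv]
    rwa [Subgroup.subset_pointwise_smul_iff, inv_inv]
  set e := c⁻¹ * d
  have hrange : (Set.range fun i => conjClass (H i)) =
      Set.range fun i => conjClass (MulAut.conj e • H i) := by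
    simp only [conjClass_conj]
  rw [← map_pow, outClass_mem_outRel_iff (inn_le_autRel_range H)] at hinv
  rw [hrange] at hproper hinv ⊢
  refine hφ.range_conjClass_eq_of_le h hg hg1 (F := MulAut.conj e • F) (fun i hi => hne i ?_) ?_
    hproper hk hinv hle'
  · have := congrArg (fun K => (MulAut.conj e)⁻¹ • K) hi
    simpa using this
  · convert hH.smul (MulAut.conj e) using 2 with i
    cases i <;> rfl

theorem IsTwist.isIWIP (hφ : IsTwist G₁ a b g₁ φ) (h : IsFreeSplitting G₁ a b)
    (hg : g₁ ∈ G₁) (hg1 : g₁ ≠ 1) : IsIWIP {conjClass G₁} (outClass φ) := by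
  have hmem : outClass φ ∈ OutRel {conjClass G₁} := ⟨φ, hφ.mem_autRel, rfl⟩
  refine ⟨hmem, fun k hk => ⟨h.isFreeFactorSystem ?_, h.isProper, pow_mem hmem k, ?_⟩⟩
  · rintro rfl
    exact hg1 hg
  · exact fun B hB hproper hinv href => hφ.eq_of_refines h hg hg1 hk hB hproper hinv href

end IsFreeSplitting

end FreeProd

/-! ### Virtually cyclic groups and the relative centraliser. -/

namespace FreeProd

section VirtuallyCyclic

theorem IsVirtuallyCyclic.of_injective {K L : Type*} [Group K] [Group L]
    (hL : IsVirtuallyCyclic L) {f : K →* L} (hf : Function.Injective f) : IsVirtuallyCyclic K := by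
  obtain ⟨N, hN, hcyc⟩ := hL
  have hfin : (N.comap f).relIndex ((⊤ : Subgroup L).comap f) ≠ 0 :=
    Subgroup.relIndex_comap_ne_zero f (by rw [Subgroup.relIndex_top_right]; exact hN.index_ne_zero)
  rw [Subgroup.comap_top, Subgroup.relIndex_top_right] at hfin
  refine ⟨N.comap f, ⟨hfin⟩, ?_⟩
  refine isCyclic_of_injective ((f.comp (N.comap f).subtype).codRestrict N fun x => x.2) ?_
  intro x y hxy
  exact Subtype.ext (hf (congrArg Subtype.val hxy))

theorem IsVirtuallyCyclic.exists_commute_pow {K : Type*} [Group K] (hK : IsVirtuallyCyclic K)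
    (u v : K) : ∃ m n : ℕ, 0 < m ∧ 0 < n ∧ Commute (u ^ m) (v ^ n) := by
  obtain ⟨N, hN, hcyc⟩ := hK
  obtain ⟨m, hm, -, hum⟩ := N.exists_pow_mem_of_index_ne_zero hN.index_ne_zero u
  obtain ⟨n, hn, -, hvn⟩ := N.exists_pow_mem_of_index_ne_zero hN.index_ne_zero v
  refine ⟨m, n, hm, hn, ?_⟩
  let _ := hcyc.commGroup
  exact congrArg Subtype.val (mul_comm (⟨u ^ m, hum⟩ : N) ⟨v ^ n, hvn⟩)

/-- The transvection of the free group on `Fin 2` multiplying the generator `i` on the right by the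
generator `j`. -/
theorem exists_transvection {i j : Fin 2} (hij : i ≠ j) :
    ∃ u : MulAut (FreeGroup (Fin 2)), u (FreeGroup.of i) = FreeGroup.of i * FreeGroup.of j ∧
      u (FreeGroup.of j) = FreeGroup.of j := by
  let f : FreeGroup (Fin 2) →* FreeGroup (Fin 2) := FreeGroup.lift
    (fun k => if k = i then FreeGroup.of i * FreeGroup.of j else FreeGroup.of k)
  let f' : FreeGroup (Fin 2) →* FreeGroup (Fin 2) := FreeGroup.lift
    (fun k => if k = i then FreeGroup.of i * (FreeGroup.of j)⁻¹ else FreeGroup.of k)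
  refine ⟨MonoidHom.toMulEquiv f f' ?_ ?_, ?_, ?_⟩
  · ext k
    by_cases hk : k = i
    · simp [f, f', hk, hij.symm]
    · simp [f, f', hk]
  · ext k
    by_cases hk : k = i
    · simp [f, f', hk, hij.symm]
    · simp [f, f', hk]
  · simp [f]
  · simp [f, hij.symm]

theorem transvection_pow {i j : Fin 2} {u : MulAut (FreeGroup (Fin 2))}
    (hi : u (FreeGroup.of i) = FreeGroup.of i * FreeGroup.of j)
    (hj : u (FreeGroup.of j) = FreeGroup.of j) (n : ℕ) :
    (u ^ n) (FreeGroup.of i) = FreeGroup.of i * FreeGroup.of j ^ n ∧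
      (u ^ n) (FreeGroup.of j) = FreeGroup.of j := by
  induction n with
  | zero => simp
  | succ n ih =>
    rw [pow_succ', MulAut.mul_apply, MulAut.mul_apply, ih.1, ih.2, map_mul, map_pow, hi, hj,
      pow_succ', mul_assoc]
    exact ⟨rfl, rfl⟩

theorem not_isVirtuallyCyclic_mulAut_freeGroup :
    ¬ IsVirtuallyCyclic (MulAut (FreeGroup (Fin 2))) := by
  intro hvc
  obtain ⟨u, hu0, hu1⟩ := exists_transvection (i := 0) (j := 1) (by decide)
  obtain ⟨v, hv1, hv0⟩ := exists_transvection (i := 1) (j := 0) (by decide)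
  obtain ⟨m, n, hm, hn, hc⟩ := hvc.exists_commute_pow u v
  have hum := transvection_pow hu0 hu1 m
  have hvn := transvection_pow hv1 hv0 n
  have h1 : (u ^ m) ((v ^ n) (FreeGroup.of 0)) = (v ^ n) ((u ^ m) (FreeGroup.of 0)) :=
    DFunLike.congr_fun hc.eq (FreeGroup.of 0)
  rw [hvn.2, hum.1, map_mul, map_pow, hvn.1, hvn.2] at h1
  -- Compare exponent sums of the generator `0`: they are `1` on the left and `1 + m * n` on the
  -- right.
  have h2 := congrArg (FreeGroup.lift ![Multiplicative.ofAdd (1 : ℤ), 1]) h1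
  simp only [map_mul, map_pow, FreeGroup.lift_apply_of, Matrix.cons_val_zero, Matrix.cons_val_one,
    one_pow, one_mul, mul_one, ← ofAdd_nsmul, ← ofAdd_add] at h2
  have h3 := Multiplicative.ofAdd.injective h2
  simp at h3
  omega

end VirtuallyCyclic

namespace IsFreeSplitting

variable {G : Type*} [Group G] {G₁ : Subgroup G} {a b g₁ : G} {φ : MulAut G}

theorem isFactorAut_unique (h : IsFreeSplitting G₁ a b) {α : MulAut G₁} {θ θ' : MulAut G}
    (hθ : IsFactorAut G₁ a b α θ) (hθ' : IsFactorAut G₁ a b α θ') : θ = θ' := by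
  have : θ.toMonoidHom = θ'.toMonoidHom := by
    apply h.hom_ext
    · intro g hg
      exact (hθ.1 ⟨g, hg⟩).trans (hθ'.1 ⟨g, hg⟩).symm
    · exact hθ.2.1.trans hθ'.2.1.symm
    · exact hθ.2.2.trans hθ'.2.2.symm
  ext x
  exact DFunLike.congr_fun this x

theorem exists_isFactorAut (h : IsFreeSplitting G₁ a b) (α : MulAut G₁) :
    ∃ θ, IsFactorAut G₁ a b α θ := by
  obtain ⟨f, hf, hfa, hfb⟩ := h.exists_extension (G₁.subtype.comp α.toMonoidHom) a b
  obtain ⟨f', hf', hfa', hfb'⟩ := h.exists_extension (G₁.subtype.comp α⁻¹.toMonoidHom) a b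
  have e : ∀ x : G₁, f x = (α x : G) := hf
  have e' : ∀ x : G₁, f' x = (α⁻¹ x : G) := hf'
  refine ⟨MonoidHom.toMulEquiv f f' ?_ ?_, hf, hfa, hfb⟩
  · apply h.hom_ext
    · intro g hg
      lift g to G₁ using hg
      simp [e, e']
    · simp [hfa, hfa']
    · simp [hfb, hfb']
  · apply h.hom_ext
    · intro g hg
      lift g to G₁ using hg
      simp [e, e']
    · simp [hfa, hfa']
    · simp [hfb, hfb']

theorem exists_factorAut_hom (h : IsFreeSplitting G₁ a b) :
    ∃ Θ : MulAut G₁ →* MulAut G, ∀ α, IsFactorAut G₁ a b α (Θ α) := by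
  choose Θ hΘ using h.exists_isFactorAut
  refine ⟨MonoidHom.mk' Θ fun α β => h.isFactorAut_unique (hΘ _) ⟨fun x => ?_, ?_, ?_⟩, hΘ⟩
  · rw [MulAut.mul_apply, (hΘ β).1, (hΘ α).1, MulAut.mul_apply]
  · rw [MulAut.mul_apply, (hΘ β).2.1, (hΘ α).2.1]
  · rw [MulAut.mul_apply, (hΘ β).2.2, (hΘ α).2.2]

/-- A factor automorphism fixes `a` and `b`, so if it is conjugation by `g`, then `g` commutes with
both and is trivial. -/
theorem eq_one_of_outClass_eq_one (h : IsFreeSplitting G₁ a b) {α : MulAut G₁} {θ : MulAut G}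
    (hθ : IsFactorAut G₁ a b α θ) (h1 : outClass θ = 1) : α = 1 := by
  obtain ⟨g, rfl⟩ := (QuotientGroup.eq_one_iff θ).1 h1
  have hg : g = 1 := h.eq_one_of_commute hθ.2.1 hθ.2.2
  ext x
  rw [← hθ.1 x, hg]
  simp

theorem isFactorAut_mem_autRel {α : MulAut G₁} {θ : MulAut G}
    (hθ : IsFactorAut G₁ a b α θ) : θ ∈ AutRel {conjClass G₁} := by
  have h1 : θ • G₁ = G₁ := by
    ext x
    constructor
    · rintro ⟨y, hy, rfl⟩
      change θ y ∈ G₁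
      rw [hθ.1 ⟨y, hy⟩]
      exact (α ⟨y, hy⟩).2
    · intro hx
      refine ⟨(α⁻¹ ⟨x, hx⟩ : G₁), Subtype.property _, ?_⟩
      change θ _ = x
      rw [hθ.1, MulAut.apply_inv_self]
  change θ • ({conjClass G₁} : Set (Set (Subgroup G))) = _
  rw [Set.smul_set_singleton, smul_conjClass, h1]

theorem IsTwist.commute_factorAut (hφ : IsTwist G₁ a b g₁ φ) (h : IsFreeSplitting G₁ a b)
    (hg : g₁ ∈ G₁) {α : MulAut G₁} (hα : α ⟨g₁, hg⟩ = ⟨g₁, hg⟩) {θ : MulAut G}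
    (hθ : IsFactorAut G₁ a b α θ) : θ * φ = φ * θ := by
  have hθg : θ g₁ = g₁ := (hθ.1 ⟨g₁, hg⟩).trans (congrArg Subtype.val hα)
  have : (θ * φ).toMonoidHom = (φ * θ).toMonoidHom := by
    apply h.hom_ext
    · intro g hg
      change θ (φ g) = φ (θ g)
      rw [hφ.map_mem g hg, hθ.1 ⟨g, hg⟩, hφ.map_mem _ (Subtype.property _)]
    · change θ (φ a) = φ (θ a)
      rw [hθ.2.1, hφ.map_left, map_mul, hθ.2.2, hθg]
    · change θ (φ b) = φ (θ b)
      rw [hθ.2.2, hφ.map_right, map_mul, hθ.2.1, hθ.2.2]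
  ext x
  exact DFunLike.congr_fun this x

theorem IsTwist.exists_stabilizer_hom (g₁ : G₁) (hφ : IsTwist G₁ a b g₁ φ)
    (h : IsFreeSplitting G₁ a b) :
    ∃ ι : MulAction.stabilizer (MulAut G₁) g₁ →* relCentraliser {conjClass G₁} (outClass φ),
      Function.Injective ι ∧
      ∀ α : MulAction.stabilizer (MulAut G₁) g₁, ∃ θ : MulAut G,
        IsFactorAut G₁ a b (α : MulAut G₁) θ ∧ (ι α : Out G) = outClass θ := by
  obtain ⟨Θ, hΘ⟩ := h.exists_factorAut_hom
  refine ⟨(outClass.comp (Θ.comp (Subgroup.subtype _))).codRestrict _ fun α => ⟨?_, ?_⟩, ?_,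
    fun α => ⟨Θ α, hΘ α, rfl⟩⟩
  · refine Subgroup.mem_centralizer_singleton_iff.2 ?_
    change outClass _ * outClass _ = outClass _ * outClass _
    rw [← map_mul, ← map_mul]
    congr 1
    exact hφ.commute_factorAut h g₁.2 (MulAction.mem_stabilizer_iff.1 α.2) (hΘ α)
  · exact ⟨_, isFactorAut_mem_autRel (hΘ α), rfl⟩
  · rw [injective_iff_map_eq_one]
    intro α hα
    exact Subtype.ext (h.eq_one_of_outClass_eq_one (hΘ α) (congrArg Subtype.val hα))

end IsFreeSplitting

/-! ### `Aut(F₂)` acting on a free group of rank three. -/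

section FreeBasis

variable {K : Type*} [Group K]

theorem lift_basis_injective (B : FreeGroupBasis (Fin 3) K) :
    Function.Injective (FreeGroup.lift ![B 1, B 2]) := by
  let r : K →* FreeGroup (Fin 2) := B.lift ![1, FreeGroup.of 0, FreeGroup.of 1]
  have hr : ∀ i, r (B i) = ![1, FreeGroup.of 0, FreeGroup.of 1] i := fun i => by simp [r]
  have : r.comp (FreeGroup.lift ![B 1, B 2]) = MonoidHom.id _ := by
    ext i
    fin_cases i
    · simp [hr]
    · simp [hr]
  exact Function.LeftInverse.injective (g := r) (DFunLike.congr_fun this)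

/-- The automorphism group of the free group of rank two acts on a free group of rank three, fixing
the first element of a basis. -/
theorem exists_mulAut_extension (B : FreeGroupBasis (Fin 3) K) :
    ∃ E : MulAut (FreeGroup (Fin 2)) →* MulAction.stabilizer (MulAut K) (B 0),
      Function.Injective E ∧ ∀ β w, (E β : MulAut K) (FreeGroup.lift ![B 1, B 2] w) =
        FreeGroup.lift ![B 1, B 2] (β w) := by
  set j : FreeGroup (Fin 2) →* K := FreeGroup.lift ![B 1, B 2] with hj
  have hj0 : j (FreeGroup.of 0) = B 1 := by simp [hj]
  have hj1 : j (FreeGroup.of 1) = B 2 := by simp [hj]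
  have hext : ∀ {f f' : K →* K}, f (B 0) = f' (B 0) → f.comp j = f'.comp j → f = f' := by
    intro f f' h0 h1
    apply B.ext_hom
    intro i
    fin_cases i
    · exact h0
    · change f (B 1) = f' (B 1)
      rw [← hj0]
      exact DFunLike.congr_fun h1 _
    · change f (B 2) = f' (B 2)
      rw [← hj1]
      exact DFunLike.congr_fun h1 _
  have hex : ∀ f : FreeGroup (Fin 2) →* FreeGroup (Fin 2),
      ∃ e : K →* K, e (B 0) = B 0 ∧ e.comp j = j.comp f := by
    intro f
    let e : K →* K := B.lift ![B 0, j (f (FreeGroup.of 0)), j (f (FreeGroup.of 1))]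
    have he : ∀ i, e (B i) = ![B 0, j (f (FreeGroup.of 0)), j (f (FreeGroup.of 1))] i :=
      fun i => by simp [e]
    refine ⟨e, he 0, ?_⟩
    ext i
    fin_cases i
    · simpa [hj0] using he 1
    · simpa [hj1] using he 2
  have hex' : ∀ β : MulAut (FreeGroup (Fin 2)), ∃ α : MulAut K, α (B 0) = B 0 ∧
      ∀ w, α (j w) = j (β w) := by
    intro β
    obtain ⟨e, he0, he⟩ := hex β.toMonoidHom
    obtain ⟨e', he0', he'⟩ := hex β⁻¹.toMonoidHom
    have h1 : ∀ w, e (j w) = j (β w) := DFunLike.congr_fun he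
    have h2 : ∀ w, e' (j w) = j (β⁻¹ w) := DFunLike.congr_fun he'
    refine ⟨MonoidHom.toMulEquiv e e' (hext ?_ ?_) (hext ?_ ?_), he0, h1⟩
    · simp [he0, he0']
    · ext w
      simp [h1, h2]
    · simp [he0, he0']
    · ext w
      simp [h1, h2]
  choose E hE0 hE using hex'
  refine ⟨MonoidHom.mk' (fun β => ⟨E β, hE0 β⟩) fun β β' => ?_, ?_, hE⟩
  · apply Subtype.ext
    have : (E (β * β')).toMonoidHom = (E β * E β').toMonoidHom := by
      apply hext
      · change E (β * β') (B 0) = E β (E β' (B 0))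
        rw [hE0, hE0, hE0]
      · ext1 w
        change E (β * β') (j _) = E β (E β' (j _))
        rw [hE, hE, hE, MulAut.mul_apply]
    ext x
    exact DFunLike.congr_fun this x
  · intro β β' h
    have h' : E β = E β' := congrArg Subtype.val h
    ext1 w
    apply lift_basis_injective B
    change j (β w) = j (β' w)
    rw [← hE, ← hE, h']

end FreeBasis

end FreeProd

theorem mainTheorem8 {G : Type*} [Group G] (G₁ : Subgroup G) (a b : G)
    (ha : orderOf a = 0) (hb : orderOf b = 0)
    (hG : FreeProd.IsInternalFreeProduct
      (![G₁, Subgroup.zpowers a, Subgroup.zpowers b] : Fin 3 → Subgroup G))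
    (g₁ : G₁) (hg₁ : g₁ ≠ 1) :
    ∃ φ : MulAut G,
      -- the automorphism, which is determined by these values
      ((∀ x : G₁, φ (x : G) = (x : G)) ∧ φ a = b * (g₁ : G) ∧ φ b = b * a) ∧
      -- it is an IWIP relative to the free factor system `{[G₁]}`
      FreeProd.IsIWIP {FreeProd.conjClass G₁} (FreeProd.outClass φ) ∧
      -- every automorphism of `G₁` fixing `g₁` extends to a factor automorphism of `G`; their
      -- classes lie in the relative centraliser and form a copy of the stabiliser of `g₁`
      (∃ ι : MulAction.stabilizer (MulAut G₁) g₁ →*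
          FreeProd.relCentraliser {FreeProd.conjClass G₁} (FreeProd.outClass φ),
        Function.Injective ι ∧
        ∀ α : MulAction.stabilizer (MulAut G₁) g₁, ∃ θ : MulAut G,
          FreeProd.IsFactorAut G₁ a b (α : MulAut G₁) θ ∧
          (ι α : FreeProd.Out G) = FreeProd.outClass θ) ∧
      -- if that stabiliser is not virtually cyclic, neither is the relative centraliser
      (¬ FreeProd.IsVirtuallyCyclic (MulAction.stabilizer (MulAut G₁) g₁) →
        ¬ FreeProd.IsVirtuallyCyclic
          (FreeProd.relCentraliser {FreeProd.conjClass G₁} (FreeProd.outClass φ))) ∧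
      -- the case where `G₁` is free of rank three and `g₁` belongs to a free basis
      (∀ B : FreeGroupBasis (Fin 3) G₁, B 0 = g₁ →
        (∃ κ : MulAut (FreeGroup (Fin 2)) →*
            FreeProd.relCentraliser {FreeProd.conjClass G₁} (FreeProd.outClass φ),
          Function.Injective κ ∧
          ∀ β : MulAut (FreeGroup (Fin 2)), ∃ (α : MulAut G₁) (θ : MulAut G),
            FreeProd.IsFactorAut G₁ a b α θ ∧
            α g₁ = g₁ ∧
            (∀ w : FreeGroup (Fin 2),
              α (FreeGroup.lift ![B 1, B 2] w) = FreeGroup.lift ![B 1, B 2] (β w)) ∧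
            (κ β : FreeProd.Out G) = FreeProd.outClass θ) ∧
        ¬ FreeProd.IsVirtuallyCyclic
          (FreeProd.relCentraliser {FreeProd.conjClass G₁} (FreeProd.outClass φ))) := by
  have h : FreeProd.IsFreeSplitting G₁ a b := ⟨ha, hb, hG⟩
  have hg1 : (g₁ : G) ≠ 1 := by simpa using hg₁
  obtain ⟨φ, hφ⟩ := h.exists_isTwist g₁.2
  obtain ⟨ι, hι, hιθ⟩ := hφ.exists_stabilizer_hom g₁ h
  refine ⟨φ, ⟨fun x => hφ.map_mem x x.2, hφ.map_left, hφ.map_right⟩, hφ.isIWIP h g₁.2 hg1,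
    ⟨ι, hι, hιθ⟩, fun hvc hC => hvc (hC.of_injective hι), ?_⟩
  rintro B rfl
  obtain ⟨E, hE, hEβ⟩ := FreeProd.exists_mulAut_extension B
  refine ⟨⟨ι.comp E, hι.comp hE, fun β => ?_⟩, fun hC =>
    FreeProd.not_isVirtuallyCyclic_mulAut_freeGroup
      (hC.of_injective (f := ι.comp E) (hι.comp hE))⟩
  obtain ⟨θ, hθ, hθι⟩ := hιθ (E β)
  exact ⟨E β, θ, hθ, (E β).2, hEβ β, hθι⟩
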